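/- **Notation.** Let $G$ be a group and $X\subseteq G$ a generating set, possibly infinite, with $X=X^{-1}$. For $g\in G$ let $|g|_X$ be the length of a shortest word in $X$ representing $g$, let $d_X(g,h)=|g^{-1}h|_X$, and let $\Gamma(G,X)$ be the (right) Cayley graph. The graph $\Gamma(G,X)$ is *hyperbolic* if for some $\delta\ge 0$ each side of every geodesic triangle lies in the $\delta$-neighbourhood of the union of the other two sides. The action of $G$ on $\Gamma(G,X)$ is *acylindrical* if for every $\varepsilon\ge 0$ there are $R,N>0$ such that for every $g\in G$ with $|g|_X\ge R$ there are at most $N$ elements $f\in G$ with $|f|_X\le\varepsilon$ and $|g^{-1}fg|_X\le\varepsilon$. An element $g\in G$ is *loxodromic* if $\mathbb Z\to\Gamma(G,X)$, $n\mapsto g^n x$, is a quasi-isometric embedding for some (equivalently, any) $x$. The *stable norm* of $g$ is $\|g\|_X=\lim_{n\to\infty}|g^n|_X/n$, and $\mathbf{inj}(G,X)$ is the infimum of the stable norms of all loxodromic elements of $G$ (if $\Gamma(G,X)$ is hyperbolic, the action is acylindrical and loxodromic elements exist, this number is positive, by a theorem of Bowditch). Two elements $a,b\in G$ of infinite order are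 *commensurable* if $a^s=g^{-1}b^tg$ for some $g\in G$ and some nonzero integers $s,t$. For $x,a\in G$, $L(x,a)$ denotes a bi-infinite path in $\Gamma(G,X)$ obtained by joining the consecutive points $\dots,xa^{-1},x,xa,\dots$ by geodesic segments such that for all $n\in\mathbb Z$ the segment $p_n$ from $xa^n$ to $xa^{n+1}$ has the same label as the segment $p_0$ from $x$ to $xa$. A subpath $p$ of $L(x,a)$ *contains at least $c$ $a$-periods* ($c\in\mathbb R$) if there are $k\in\mathbb N$, $k\ge c$, and $n\in\mathbb Z$ such that $p_np_{n+1}\cdots p_{n+k-1}$ is a subpath of $p$. A path *lies in the $r$-neighbourhood* of another path if each of its vertices is at distance at most $r$ from some vertex of the other path. **Theorem.** Let $G$ be a group and $X$ a generating set of $G$ with $X=X^{-1}$. Suppose that the Cayley graph $\Gamma(G,X)$ is hyperbolic and that $G$ acts acylindrically on $\Gamma(G,X)$. Then there exists a constant $C>0$ such that the following holds. Let $a,b\in G$ be two loxodromic elements which are shortest in their conjugacy classes and such that $|a|_X\ge|b|_X$. Let $x,y\in G$ be arbitrary elements and $r$ an arbitrary non-negative integer, and put $f(r)=\dfrac{2r}{\mathbf{inj}(G,X)}+C$.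 If a subpath $p$ of $L(x,a)$ contains at least $f(r)$ $a$-periods and lies in the $r$-neighbourhood of $L(y,b)$, then there exist integers $s,t\ne 0$ such that $(x^{-1}y)\,b^s\,(y^{-1}x)=a^t$. In particular, $a$ and $b$ are commensurable. The constant $C$ depends only on $G$ and $X$; the conclusion holds for every choice of the geodesic segments in $L(x,a)$ and $L(y,b)$. -/

import Mathlib

open Filter Topology

/-- A graph is (Gromov-)hyperbolic if it is connected and, for some `δ ≥ 0`, all its geodesic
triangles are `δ`-slim.  Geodesics are walks whose length is the distance of their ends.  It is
enough to say that the side `p` lies in the `δ`-neighbourhood of the union of the other two, since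
the condition is required for all three cyclic orders of the sides of a triangle. -/
def SimpleGraph.IsGromovHyperbolic {V : Type*} (Γ : SimpleGraph V) : Prop :=
  Γ.Connected ∧ ∃ δ : ℝ, 0 ≤ δ ∧
    ∀ (A B C : V) (p : Γ.Walk A B) (q : Γ.Walk B C) (r : Γ.Walk C A),
      p.length = Γ.dist A B → q.length = Γ.dist B C → r.length = Γ.dist C A →
      ∀ P ∈ p.support, ∃ Q : V, (Q ∈ q.support ∨ Q ∈ r.support) ∧ (Γ.dist P Q : ℝ) ≤ δ

namespace GroupGeometry

variable {G : Type*} [Group G]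

/-- `u` is a word in the alphabet `X` that represents `g`. -/
def IsWordFor (X : Set G) (u : List G) (g : G) : Prop :=
  (∀ s ∈ u, s ∈ X) ∧ u.prod = g

/-- The length `|g|_X` of a shortest word in `X` that represents `g`. -/
noncomputable def wordLength (X : Set G) (g : G) : ℕ :=
  sInf {n : ℕ | ∃ u : List G, IsWordFor X u g ∧ u.length = n}

/-- The word metric `d_X(g, h) = |g⁻¹ h|_X`. -/
noncomputable def wordDist (X : Set G) (g h : G) : ℕ :=
  wordLength X (g⁻¹ * h)

/-- A shortest word in `X` that represents `g`, that is, the label of a geodesic segment from `x`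
to `x * g` in the Cayley graph. -/
def IsShortestWordFor (X : Set G) (u : List G) (g : G) : Prop :=
  IsWordFor X u g ∧ u.length = wordLength X g

/-- The action of `G` on its Cayley graph with respect to `X` is acylindrical. -/
def IsAcylindrical (X : Set G) : Prop :=
  ∀ ε : ℝ, 0 ≤ ε → ∃ R : ℝ, ∃ N : ℕ, 0 < R ∧ 0 < N ∧
    ∀ g : G, R ≤ (wordLength X g : ℝ) →
      {f : G | (wordLength X f : ℝ) ≤ ε ∧ (wordLength X (g⁻¹ * f * g) : ℝ) ≤ ε}.encard ≤ N

/-- `g` is loxodromic with respect to `X`: the orbit map `n ↦ gⁿ x` is a quasi-isometric embedding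
of `ℤ` for some vertex `x` of the Cayley graph. -/
def IsLoxodromic (X : Set G) (g : G) : Prop :=
  ∃ x : G, ∃ l c : ℝ, 1 ≤ l ∧ 0 ≤ c ∧ ∀ m n : ℤ,
    |(m : ℝ) - n| / l - c ≤ wordDist X (g ^ m * x) (g ^ n * x) ∧
      (wordDist X (g ^ m * x) (g ^ n * x) : ℝ) ≤ l * |(m : ℝ) - n| + c

/-- The stable norm `‖g‖_X = lim |gⁿ|_X / n` (the limit exists, see `tendsto_stableNorm`). -/
noncomputable def stableNorm (X : Set G) (g : G) : ℝ :=
  limUnder atTop fun n : ℕ => (wordLength X (g ^ n) : ℝ) / n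

/-- The injectivity radius: the infimum of the stable norms of the loxodromic elements. -/
noncomputable def injRadius (X : Set G) : ℝ :=
  sInf {t : ℝ | ∃ g : G, IsLoxodromic X g ∧ stableNorm X g = t}

/-- `g` is shortest in its conjugacy class. -/
def IsShortestInConjClass (X : Set G) (g : G) : Prop :=
  ∀ h : G, wordLength X g ≤ wordLength X (h⁻¹ * g * h)

/-- Two elements of infinite order are commensurable if a nontrivial power of one is conjugate to a
nontrivial power of the other. -/
def IsCommensurable (a b : G) : Prop :=
  ¬ IsOfFinOrder a ∧ ¬ IsOfFinOrder b ∧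
    ∃ (g : G) (s t : ℤ), s ≠ 0 ∧ t ≠ 0 ∧ a ^ s = g⁻¹ * b ^ t * g

/-- The bi-infinite path `L(x, a)`, where `a` is represented by the word `u`, given by its vertices:
if `u = u₁ ⋯ uₗ` then the vertex number `n * l + k` (`0 ≤ k < l`) is `x aⁿ u₁ ⋯ uₖ`.  So vertex
number `n * l` is the phase vertex `x aⁿ`, and the segment from `x aⁿ` to `x aⁿ⁺¹` has label `u` for
every `n : ℤ`. -/
def periodicPath (x : G) (u : List G) (i : ℤ) : G :=
  x * u.prod ^ (i / (u.length : ℤ)) * (u.take (i % (u.length : ℤ)).toNat).prod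

/-- The subpath of `L(x, a)` carried by a set `I` of consecutive indices contains `k` `a`-periods:
for some `n`, the union of the periods number `n, …, n + k - 1` is a subpath of it.  Here `l` is the
length of a period, so that period number `m` runs from vertex number `m * l` to `(m + 1) * l`. -/
def ContainsPeriods (l : ℕ) (I : Set ℤ) (k : ℕ) : Prop :=
  ∃ n : ℤ, Set.Icc (n * l) ((n + k) * l) ⊆ I

theorem exists_word (X : Set G) (hsymm : ∀ s ∈ X, s⁻¹ ∈ X) (hgen : Subgroup.closure X = ⊤)
    (g : G) : ∃ u : List G, IsShortestWordFor X u g := by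
  have hne : {n : ℕ | ∃ u : List G, IsWordFor X u g ∧ u.length = n}.Nonempty := by
    have hg : g ∈ Subgroup.closure X := by rw [hgen]; trivial
    have hX : X ∪ X⁻¹ = X := by
      apply Set.union_eq_self_of_subset_right
      intro s hs
      simpa using hsymm _ hs
    rw [← Subgroup.mem_toSubmonoid, Subgroup.closure_toSubmonoid, hX] at hg
    obtain ⟨u, hu, hp⟩ := Submonoid.exists_list_of_mem_closure hg
    exact ⟨u.length, u, ⟨hu, hp⟩, rfl⟩
  exact Nat.sInf_mem hne

theorem wordLength_le {X : Set G} {u : List G} {g : G} (h : IsWordFor X u g) :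
    wordLength X g ≤ u.length :=
  Nat.sInf_le ⟨u, h, rfl⟩

theorem wordLength_mul_le (X : Set G) (hsymm : ∀ s ∈ X, s⁻¹ ∈ X)
    (hgen : Subgroup.closure X = ⊤) (g h : G) :
    wordLength X (g * h) ≤ wordLength X g + wordLength X h := by
  obtain ⟨u, ⟨hu, hug⟩, hul⟩ := exists_word X hsymm hgen g
  obtain ⟨v, ⟨hv, hvh⟩, hvl⟩ := exists_word X hsymm hgen h
  rw [← hul, ← hvl, ← List.length_append]
  refine wordLength_le ⟨fun s hs => ?_, by simp [hug, hvh]⟩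
  rcases List.mem_append.1 hs with hs | hs
  exacts [hu s hs, hv s hs]

/-- The limit that defines the stable norm exists. -/
theorem tendsto_stableNorm (X : Set G) (hsymm : ∀ s ∈ X, s⁻¹ ∈ X)
    (hgen : Subgroup.closure X = ⊤) (g : G) :
    Tendsto (fun n : ℕ => (wordLength X (g ^ n) : ℝ) / n) atTop (𝓝 (stableNorm X g)) := by
  have hs : Subadditive fun n : ℕ => (wordLength X (g ^ n) : ℝ) := by
    intro m n
    simp only [pow_add]
    exact_mod_cast wordLength_mul_le X hsymm hgen _ _
  refine tendsto_nhds_limUnder ⟨_, hs.tendsto_lim ⟨0, ?_⟩⟩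
  rintro _ ⟨n, rfl⟩
  positivity

/-- A walk in the Cayley graph is labelled by a word of the same length. -/
theorem exists_word_of_walk {X : Set G} (hsymm : ∀ s ∈ X, s⁻¹ ∈ X) {g h : G}
    (p : (SimpleGraph.mulCayley X).Walk g h) :
    ∃ u : List G, IsWordFor X u (g⁻¹ * h) ∧ u.length = p.length := by
  induction p with
  | nil => exact ⟨[], ⟨by simp, by simp⟩, rfl⟩
  | @cons a b c hab p ih =>
    obtain ⟨u, ⟨hu, hup⟩, hul⟩ := ih
    refine ⟨(a⁻¹ * b) :: u, ⟨fun s hs => ?_, by simp [hup, mul_assoc]⟩, by simp [hul]⟩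
    rcases List.mem_cons.1 hs with rfl | hs
    · obtain ⟨-, t, ht, h | h⟩ := (SimpleGraph.mulCayley_adj' X a b).1 hab
      · simpa [← h] using ht
      · simpa [h] using hsymm t ht
    · exact hu s hs

/-- A word labels a walk in the Cayley graph that is at most as long (letters equal to `1` are
skipped). -/
theorem exists_walk_of_word {X : Set G} {u : List G} (hu : ∀ s ∈ u, s ∈ X) (g : G) :
    ∃ p : (SimpleGraph.mulCayley X).Walk g (g * u.prod), p.length ≤ u.length := by
  induction u generalizing g with
  | nil =>
    exact ⟨SimpleGraph.Walk.nil.copy rfl (by simp), by rw [SimpleGraph.Walk.length_copy]; simp⟩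
  | cons s u ih =>
    obtain ⟨p, hp⟩ := ih (fun t ht => hu t (List.mem_cons_of_mem _ ht)) (g * s)
    have e : g * s * u.prod = g * (s :: u).prod := by simp [mul_assoc]
    by_cases hs : s = 1
    · exact ⟨p.copy (by simp [hs]) e, by rw [SimpleGraph.Walk.length_copy]; simp; omega⟩
    · have hadj : (SimpleGraph.mulCayley X).Adj g (g * s) :=
        (SimpleGraph.mulCayley_adj' X _ _).2
          ⟨by simpa using hs, s, hu s List.mem_cons_self, Or.inl rfl⟩
      exact ⟨(SimpleGraph.Walk.cons hadj p).copy rfl e,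
        by rw [SimpleGraph.Walk.length_copy]; simp; omega⟩

/-- The word metric is the path metric of the Cayley graph. -/
theorem dist_mulCayley (X : Set G) (hsymm : ∀ s ∈ X, s⁻¹ ∈ X) (hgen : Subgroup.closure X = ⊤)
    (g h : G) : (SimpleGraph.mulCayley X).dist g h = wordDist X g h := by
  obtain ⟨u, ⟨hu, hup⟩, hul⟩ := exists_word X hsymm hgen (g⁻¹ * h)
  obtain ⟨p, hp⟩ := exists_walk_of_word hu g
  have e : g * u.prod = h := by simp [hup]
  apply le_antisymm
  · rw [wordDist, ← hul]
    refine le_trans (SimpleGraph.dist_le (p.copy rfl e)) (by simpa using hp)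
  · obtain ⟨q, hq⟩ := (p.copy rfl e).reachable.exists_walk_length_eq_dist
    obtain ⟨v, hv, hvl⟩ := exists_word_of_walk hsymm q
    rw [← hq, ← hvl]
    exact wordLength_le hv

end GroupGeometry

/-! Put `A = x a x⁻¹` and `B = y b y⁻¹`; they act by left multiplication along `L(x, a)` and `L(y,
b)`. The goal is a common power of `A` and `B`, obtained by using acylindricity as a pigeonhole
principle.

Acylindricity bounds the stable norms of loxodromic elements below by some `η > 0`
(`exists_le_translationLength`). For elements shortest in their conjugacy classes this gives `|aⁿ| ≤
n‖a‖ + c` with a uniform `c` (`exists_dist_pow_le`), so the orbits are uniform coarse geodesics, and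
a pair of Busemann functions serves as a coordinate along them (`CoarseAxis`, `exists_coarseAxis`).

If both ends of an orbit segment of `A` are `r`-close to the axis of `B`, then all of it except
about `r / inj` periods at each end is close to that axis with a constant independent of `r`
(`add_le_of_near`). This is the source of `2r / inj`. On the remaining segment `A` and `B` are
almost translations of the same line, so the commutators `Aⁱ B A⁻ⁱ B⁻¹` move two distant points by a
bounded amount. Two of them coincide, and a power `D` of `A` commutes with `B`
(`exists_commute_pow`).

The powers of `B` then stay near the axis of `A`. Corrected by powers of `D`, they have bounded
displacement at two distant points. A second pigeonhole gives the common power, which is nontrivial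
since `B` has infinite order (`exists_zpow_eq_of_commute`). -/

/-! ### From slim triangles to the four point condition -/

theorem SimpleGraph.Walk.dist_add_dist_le_of_mem_support {V : Type*} {Γ : SimpleGraph V} {A B : V}
    {p : Γ.Walk A B} (hp : p.length = Γ.dist A B) {P : V} (hP : P ∈ p.support) :
    Γ.dist A P + Γ.dist P B ≤ Γ.dist A B := by
  classical
  have h := congrArg SimpleGraph.Walk.length (p.take_spec hP)
  rw [SimpleGraph.Walk.length_append] at h
  have h1 := SimpleGraph.dist_le (p.takeUntil P hP)
  have h2 := SimpleGraph.dist_le (p.dropUntil P hP)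
  omega

/-- Discrete connectedness: the first edge whose head satisfies `T` has a tail satisfying `S`. It
serves to find the centre of a geodesic triangle on one of its sides. -/
theorem SimpleGraph.Walk.exists_mem_support_near_both {V : Type*} {Γ : SimpleGraph V} {A B : V}
    (p : Γ.Walk A B) (S T : V → Prop) (hA : S A) (hB : T B) (hST : ∀ P ∈ p.support, S P ∨ T P) :
    ∃ P ∈ p.support, S P ∧ ∃ Q, T Q ∧ Γ.dist P Q ≤ 1 := by
  induction p with
  | nil => exact ⟨_, by simp, hA, _, hB, by simp⟩
  | @cons a b c hab p ih =>
    by_cases hb : T b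
    · exact ⟨a, by simp, hA, b, hb, by simpa using SimpleGraph.dist_le (hab.toWalk)⟩
    · have hSb : S b := (hST b (by simp)).resolve_right hb
      obtain ⟨P, hP, h⟩ := ih hSb hB fun P hP => hST P (by simp [hP])
      exact ⟨P, by simp [hP], h⟩

/-- Slim triangles imply the four point condition. -/
theorem SimpleGraph.IsGromovHyperbolic.four_point {V : Type*} {Γ : SimpleGraph V}
    (h : Γ.IsGromovHyperbolic) : ∃ δ : ℝ, 0 ≤ δ ∧ ∀ x y z w : V,
      (Γ.dist x y : ℝ) + Γ.dist z w ≤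
        max ((Γ.dist x z : ℝ) + Γ.dist y w) ((Γ.dist x w : ℝ) + Γ.dist y z) + δ := by
  obtain ⟨hc, δ, hδ, H⟩ := h
  have tri : ∀ a b c : V, (Γ.dist a c : ℝ) ≤ Γ.dist a b + Γ.dist b c := fun a b c => by
    exact_mod_cast hc.dist_triangle
  have comm : ∀ a b : V, (Γ.dist a b : ℝ) = Γ.dist b a := fun a b => by rw [SimpleGraph.dist_comm]
  -- By slimness, a point of `[x, y]` lies almost on a geodesic from `x` to `z` or from `y` to `z`.
  have key : ∀ (x y z : V) (p : Γ.Walk x y), p.length = Γ.dist x y → ∀ P ∈ p.support,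
      ((Γ.dist x P : ℝ) + Γ.dist P z ≤ Γ.dist x z + 2 * δ) ∨
        ((Γ.dist y P : ℝ) + Γ.dist P z ≤ Γ.dist y z + 2 * δ) := by
    intro x y z p hp P hP
    obtain ⟨q, hq⟩ := hc.exists_walk_length_eq_dist y z
    obtain ⟨r, hr⟩ := hc.exists_walk_length_eq_dist z x
    obtain ⟨Q, hQ | hQ, hPQ⟩ := H x y z p q r hp hq hr P hP
    · right
      have h1 : (Γ.dist y Q : ℝ) + Γ.dist Q z ≤ Γ.dist y z := by
        exact_mod_cast SimpleGraph.Walk.dist_add_dist_le_of_mem_support hq hQ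
      linarith [tri y Q P, tri P Q z, comm P Q]
    · left
      have h1 : (Γ.dist z Q : ℝ) + Γ.dist Q x ≤ Γ.dist z x := by
        exact_mod_cast SimpleGraph.Walk.dist_add_dist_le_of_mem_support hr hQ
      linarith [tri x Q P, tri P Q z, comm P Q, comm z Q, comm Q x, comm z x]
  refine ⟨4 * δ + 2, by positivity, fun x y z w => ?_⟩
  obtain ⟨p, hp⟩ := hc.exists_walk_length_eq_dist x y
  have self : ∀ a : V, (Γ.dist a a : ℝ) = 0 := fun a => by simp
  -- `P` satisfies both alternatives for `z`, the second up to an error 2. Whichever alternative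
  -- holds for `w`, adding it to the opposite one for `z` gives the inequality with constant `4δ +
  -- 2`.
  obtain ⟨P, hP, hS, Q, hT, hPQ⟩ := p.exists_mem_support_near_both
    (fun P => (Γ.dist x P : ℝ) + Γ.dist P z ≤ Γ.dist x z + 2 * δ)
    (fun P => (Γ.dist y P : ℝ) + Γ.dist P z ≤ Γ.dist y z + 2 * δ)
    (by simp [hδ]) (by simp [hδ]) (key x y z p hp)
  have hPQ' : (Γ.dist P Q : ℝ) ≤ 1 := by exact_mod_cast hPQ
  rcases key x y w p hp P hP with h1 | h1
  · have := le_max_right ((Γ.dist x z : ℝ) + Γ.dist y w) ((Γ.dist x w : ℝ) + Γ.dist y z)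
    linarith [tri x P y, tri z P w, comm P Q, tri y Q P, tri P Q z, comm P y, comm z P]
  · have := le_max_left ((Γ.dist x z : ℝ) + Γ.dist y w) ((Γ.dist x w : ℝ) + Γ.dist y z)
    linarith [tri x P y, tri z P w, comm P y, comm z P]

/-! ### Left invariant hyperbolic metrics on a group -/

namespace GroupGeometry

variable {G : Type*} [Group G]

/-- A left invariant, integer valued, coarsely geodesic metric on a group that satisfies the four
point condition with constant `δ`. -/
structure IsHyperbolicMetric (d : G → G → ℝ) (δ : ℝ) : Prop where
  self : ∀ x, d x x = 0
  symm : ∀ x y, d x y = d y x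
  triangle : ∀ x y z, d x z ≤ d x y + d y z
  mul_left : ∀ g x y, d (g * x) (g * y) = d x y
  exists_nat : ∀ x y, ∃ n : ℕ, d x y = n
  exists_mid : ∀ g, ∃ m, d 1 m + d m g ≤ d 1 g ∧ |d 1 m - d 1 g / 2| ≤ 1 / 2
  nonneg_const : 0 ≤ δ
  four_point : ∀ x y z w, d x y + d z w ≤ max (d x z + d y w) (d x w + d y z) + δ

theorem isHyperbolicMetric_wordDist {X : Set G} (hsymm : ∀ s ∈ X, s⁻¹ ∈ X)
    (hgen : Subgroup.closure X = ⊤) (hhyp : (SimpleGraph.mulCayley X).IsGromovHyperbolic) :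
    ∃ δ, IsHyperbolicMetric (fun g h => (wordDist X g h : ℝ)) δ := by
  obtain ⟨δ, hδ, H⟩ := hhyp.four_point
  have hc := hhyp.1
  simp only [dist_mulCayley X hsymm hgen] at H
  have tri : ∀ x y z, wordDist X x z ≤ wordDist X x y + wordDist X y z := fun x y z => by
    simp only [← dist_mulCayley X hsymm hgen]; exact hc.dist_triangle
  refine ⟨δ, ?_, ?_, ?_, ?_, ?_, ?_, hδ, H⟩
  · intro x; simp [← dist_mulCayley X hsymm hgen]
  · intro x y; simp only [← dist_mulCayley X hsymm hgen, SimpleGraph.dist_comm]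
  · intro x y z; exact_mod_cast tri x y z
  · intro g x y; simp [wordDist, mul_assoc]
  · intro x y; exact ⟨_, rfl⟩
  · intro g
    obtain ⟨u, ⟨hu, hug⟩, hul⟩ := exists_word X hsymm hgen g
    -- The first half of a shortest word ends at a coarse midpoint; odd lengths cost the error
    -- `1/2`.
    have h1 : wordDist X 1 (u.take (u.length / 2)).prod ≤ u.length / 2 := by
      have := wordLength_le (X := X) (u := u.take (u.length / 2))
        ⟨fun s hs => hu s (List.mem_of_mem_take hs), rfl⟩
      simp only [wordDist, inv_one, one_mul]
      exact this.trans (by simp)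
    have h2 : wordDist X (u.take (u.length / 2)).prod g ≤ u.length - u.length / 2 := by
      have := wordLength_le (X := X) (u := u.drop (u.length / 2))
        (g := ((u.take (u.length / 2)).prod)⁻¹ * g)
        ⟨fun s hs => hu s (List.mem_of_mem_drop hs), by
          rw [eq_inv_mul_iff_mul_eq, List.prod_take_mul_prod_drop, hug]⟩
      simpa [wordDist] using this
    have h3 : wordDist X 1 g = u.length := by simp [wordDist, hul]
    have h4 := tri 1 (u.take (u.length / 2)).prod g
    refine ⟨(u.take (u.length / 2)).prod, by exact_mod_cast (by omega), ?_⟩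
    have h5 : wordDist X 1 (u.take (u.length / 2)).prod = u.length / 2 := by omega
    rw [h5, h3, abs_le]
    have h6 : u.length ≤ 2 * (u.length / 2) + 1 := by omega
    have h7 : 2 * (u.length / 2) ≤ u.length := by omega
    have h6' : (u.length : ℝ) ≤ 2 * ((u.length / 2 : ℕ) : ℝ) + 1 := by exact_mod_cast h6
    have h7' : 2 * ((u.length / 2 : ℕ) : ℝ) ≤ (u.length : ℝ) := by exact_mod_cast h7
    constructor <;> linarith

end GroupGeometry

/-! ### Translation lengths and displacements of powers -/

namespace GroupGeometry

variable {G : Type*} [Group G]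

/-- `τ` is the translation length of `g`. -/
def HasTranslationLength (d : G → G → ℝ) (g : G) (τ : ℝ) : Prop :=
  Tendsto (fun n : ℕ => d 1 (g ^ n) / n) atTop (𝓝 τ)

namespace IsHyperbolicMetric

variable {d : G → G → ℝ} {δ : ℝ}

theorem dist_nonneg (H : IsHyperbolicMetric d δ) (x y : G) : 0 ≤ d x y := by
  have := H.triangle x y x
  rw [H.self, H.symm y x] at this
  linarith

theorem dist_pow (H : IsHyperbolicMetric d δ) (g : G) {i j : ℕ} (n : ℕ) (h : i + n = j) :
    d (g ^ i) (g ^ j) = d 1 (g ^ n) := by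
  have := H.mul_left (g ^ i) 1 (g ^ n)
  rwa [mul_one, ← pow_add, h] at this

theorem dist_pow' (H : IsHyperbolicMetric d δ) (g : G) {i j : ℕ} (n : ℕ) (h : i + n = j) :
    d (g ^ j) (g ^ i) = d 1 (g ^ n) := by
  rw [H.symm, H.dist_pow g n h]

theorem dist_pow_add_le (H : IsHyperbolicMetric d δ) (g : G) (m n : ℕ) :
    d 1 (g ^ (m + n)) ≤ d 1 (g ^ m) + d 1 (g ^ n) := by
  have := H.triangle 1 (g ^ m) (g ^ (m + n))
  rwa [H.dist_pow g n rfl] at this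

theorem dist_pow_mul_le (H : IsHyperbolicMetric d δ) (g : G) (n k : ℕ) :
    d 1 (g ^ (n * k)) ≤ k * d 1 (g ^ n) := by
  induction k with
  | zero => simp [H.self]
  | succ k ih =>
    have := H.dist_pow_add_le g (n * k) n
    rw [mul_add_one]
    push_cast
    linarith

theorem dist_one_conj (H : IsHyperbolicMetric d δ) (g h : G) :
    d 1 (h⁻¹ * g * h) = d h (g * h) := by
  rw [← H.mul_left h 1]; simp [mul_assoc]

/-- Translation lengths bound displacements from below. -/
theorem mul_translationLength_le (H : IsHyperbolicMetric d δ) {g : G} {τ : ℝ}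
    (hg : HasTranslationLength d g τ) (n : ℕ) : n * τ ≤ d 1 (g ^ n) := by
  rcases Nat.eq_zero_or_pos n with rfl | hn
  · simp [H.self]
  have hn' : (0 : ℝ) < n := by exact_mod_cast hn
  have ht : Tendsto (fun k : ℕ => d 1 (g ^ (n * k)) / (n * k : ℕ)) atTop (𝓝 τ) :=
    hg.comp (tendsto_id.const_mul_atTop' hn)
  rw [← le_div_iff₀' hn']
  refine le_of_tendsto ht ?_
  filter_upwards [eventually_ge_atTop 1] with k hk
  have hk' : (0 : ℝ) < k := by exact_mod_cast hk
  push_cast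
  rw [div_le_div_iff₀ (by positivity) hn']
  nlinarith [H.dist_pow_mul_le g n k]

theorem translationLength_nonneg (H : IsHyperbolicMetric d δ) {g : G} {τ : ℝ}
    (hg : HasTranslationLength d g τ) : 0 ≤ τ :=
  ge_of_tendsto' hg fun n => div_nonneg (H.dist_nonneg _ _) (Nat.cast_nonneg n)

/-- Displacements are bounded from above in terms of the translation length if the powers of `g`
form a coarse geodesic. -/
theorem dist_pow_le_of_superadditive (H : IsHyperbolicMetric d δ) {g : G} {τ c : ℝ}
    (hg : HasTranslationLength d g τ) (hc : 0 ≤ c)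
    (hs : ∀ m n : ℕ, 1 ≤ m → 1 ≤ n → d 1 (g ^ m) + d 1 (g ^ n) ≤ d 1 (g ^ (m + n)) + c) (n : ℕ) :
    d 1 (g ^ n) ≤ n * τ + c := by
  rcases Nat.eq_zero_or_pos n with rfl | hn
  · simp [H.self, hc]
  have hn' : (0 : ℝ) < n := by exact_mod_cast hn
  have ht : Tendsto (fun k : ℕ => d 1 (g ^ (n * k)) / (n * k : ℕ)) atTop (𝓝 τ) :=
    hg.comp (tendsto_id.const_mul_atTop' hn)
  -- Fekete's argument: after subtracting `c`, displacements are superadditive along the multiples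
  -- of `n`.
  have hk : ∀ k : ℕ, (k + 1 : ℝ) * (d 1 (g ^ n) - c) ≤ d 1 (g ^ (n * (k + 1))) - c := by
    intro k
    induction k with
    | zero => simp
    | succ k ih =>
      have := hs (n * (k + 1)) n (Nat.mul_pos hn k.succ_pos) hn
      rw [mul_add_one n (k + 1)]
      push_cast
      linarith
  rw [← sub_le_iff_le_add, ← div_le_iff₀' hn']
  refine ge_of_tendsto ht ?_
  filter_upwards [eventually_ge_atTop 1] with k hk1
  obtain ⟨k, rfl⟩ : ∃ j, k = j + 1 := ⟨k - 1, by omega⟩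
  push_cast
  rw [div_le_div_iff₀ hn' (by positivity)]
  nlinarith [hk k]

theorem _root_.GroupGeometry.HasTranslationLength.pow {g : G} {τ : ℝ}
    (hg : HasTranslationLength d g τ) {M : ℕ} (hM : 0 < M) :
    HasTranslationLength d (g ^ M) (M * τ) := by
  have ht : Tendsto (fun k : ℕ => (M : ℝ) * (d 1 (g ^ (M * k)) / (M * k : ℕ))) atTop (𝓝 (M * τ)) :=
    (hg.comp (tendsto_id.const_mul_atTop' hM)).const_mul _
  refine ht.congr fun k => ?_
  rw [← pow_mul]
  have hM' : (M : ℝ) ≠ 0 := by exact_mod_cast hM.ne'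
  push_cast
  field_simp

/-- Conjugation by `h` changes every displacement by at most `2 * d 1 h`, which vanishes after
division by `n`. -/
theorem translationLength_conj (H : IsHyperbolicMetric d δ) {g : G} {τ : ℝ}
    (hg : HasTranslationLength d g τ) (h : G) : HasTranslationLength d (h⁻¹ * g * h) τ := by
  have h0 : Tendsto (fun n : ℕ => 2 * d 1 h / (n : ℝ)) atTop (𝓝 0) :=
    tendsto_const_div_atTop_nhds_zero_nat _
  have e : ∀ n : ℕ, d 1 ((h⁻¹ * g * h) ^ n) = d h (g ^ n * h) := fun n => by
    have := conj_pow (a := h⁻¹) (b := g) (i := n)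
    rw [inv_inv] at this
    rw [this, H.dist_one_conj]
  have h1 : ∀ n : ℕ, d (g ^ n) (g ^ n * h) = d 1 h := fun n => by
    simpa using H.mul_left (g ^ n) 1 h
  refine tendsto_of_tendsto_of_tendsto_of_le_of_le (by simpa using hg.sub h0)
    (by simpa using hg.add h0) (fun n => ?_) (fun n => ?_)
  · simp only [e, ← sub_div]
    gcongr
    linarith [H.triangle 1 h (g ^ n), H.triangle h (g ^ n * h) (g ^ n), h1 n,
      H.symm (g ^ n) (g ^ n * h)]
  · simp only [e, ← add_div]
    gcongr
    linarith [H.triangle h 1 (g ^ n * h), H.triangle 1 (g ^ n) (g ^ n * h), h1 n, H.symm 1 h]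

/-- Local to global: in the four point condition for `1, gⁿ⁺², gⁿ⁺¹, gⁿ⁺³`, the growth at the
previous step rules out the alternative without `gⁿ⁺³`, so the growth persists. -/
theorem dist_pow_succ_of_dist_sq (H : IsHyperbolicMetric d δ) {g : G}
    (hg : d 1 g + 2 * δ < d 1 (g ^ 2)) (n : ℕ) :
    d 1 (g ^ (n + 1)) + (d 1 (g ^ 2) - d 1 g - δ) ≤ d 1 (g ^ (n + 2)) := by
  have hδ := H.nonneg_const
  induction n with
  | zero => simp; linarith
  | succ n ih =>
    have h4 := H.four_point (g ^ 0) (g ^ (n + 2)) (g ^ (n + 1)) (g ^ (n + 3))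
    rw [H.dist_pow g (n + 2) (by omega), H.dist_pow g 2 (by omega),
      H.dist_pow g (n + 1) (by omega), H.dist_pow g 1 (by omega),
      H.dist_pow g (n + 3) (by omega), H.dist_pow' g 1 (by omega), pow_one] at h4
    rcases max_cases (d 1 (g ^ (n + 1)) + d 1 g) (d 1 (g ^ (n + 3)) + d 1 g) with h | h
    · linarith
    · show d 1 (g ^ (n + 2)) + _ ≤ d 1 (g ^ (n + 3))
      linarith

/-- If `g²` moves the base point sufficiently further than `g`, then the powers of `g` form a coarse
geodesic. -/
theorem superadditive_of_dist_sq (H : IsHyperbolicMetric d δ) {g : G}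
    (hg : d 1 g + 2 * δ < d 1 (g ^ 2)) (m n : ℕ) (hm : 1 ≤ m) (hn : 1 ≤ n) :
    d 1 (g ^ m) + d 1 (g ^ n) ≤ d 1 (g ^ (m + n)) + (2 * d 1 g - d 1 (g ^ 2) + 2 * δ) := by
  have hδ := H.nonneg_const
  obtain ⟨m, rfl⟩ : ∃ j, m = j + 1 := ⟨m - 1, by omega⟩
  obtain ⟨n, rfl⟩ : ∃ j, n = j + 1 := ⟨n - 1, by omega⟩
  have hm' := H.dist_pow_succ_of_dist_sq hg m
  have hn' : d 1 (g ^ n) + δ < d 1 (g ^ (n + 1)) := by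
    cases n with
    | zero =>
      have := H.dist_pow_add_le g 1 1
      simp [H.self] at this ⊢
      linarith
    | succ n => have := H.dist_pow_succ_of_dist_sq hg n; linarith
  have h4 := H.four_point (g ^ 0) (g ^ (m + 2)) (g ^ (m + 1)) (g ^ (m + 1 + (n + 1)))
  rw [H.dist_pow g (m + 2) (by omega), H.dist_pow g (n + 1) (by omega),
    H.dist_pow g (m + 1) (by omega), H.dist_pow g n (by omega),
    H.dist_pow g (m + 1 + (n + 1)) (by omega), H.dist_pow' g 1 (by omega), pow_one] at h4
  rcases max_cases (d 1 (g ^ (m + 1)) + d 1 (g ^ n)) (d 1 (g ^ (m + 1 + (n + 1))) + d 1 g)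
    with h | h <;> linarith

/-- Since `g` moves the midpoint `m` of `[1, g]` at least as far as `1`, the segments `[m, g]` and
`[g, gm]` cannot backtrack. Two four point inequalities extend this to `[1, g]` and `[g, g²]`, each
at the cost of `δ`. -/
theorem dist_sq_of_shortest (H : IsHyperbolicMetric d δ) {g : G} (hL : 4 * δ + 2 < d 1 g)
    (hg : ∀ h, d 1 g ≤ d 1 (h⁻¹ * g * h)) : 2 * d 1 g - 2 * δ ≤ d 1 (g ^ 2) := by
  have hδ := H.nonneg_const
  obtain ⟨m, hm, hm'⟩ := H.exists_mid g
  rw [abs_le] at hm'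
  have h1 : d 1 g ≤ d m (g * m) := H.dist_one_conj g m ▸ hg m
  have h2 : d g (g * m) = d 1 m := by simpa using H.mul_left g 1 m
  have h3 : d (g * m) (g ^ 2) = d m g := by rw [pow_two, H.mul_left]
  have h5 : d g (g ^ 2) = d 1 g := by simpa [pow_two] using H.mul_left g 1 g
  have h6 := H.triangle 1 m g
  have f1 := H.four_point 1 g m (g * m)
  have f2 := H.four_point 1 (g * m) g (g ^ 2)
  rw [H.symm g m, h2] at f1
  rw [h3, h5, H.symm (g * m) g, h2] at f2
  rcases max_cases (d 1 m + d 1 m) (d 1 (g * m) + d m g) with h | h <;>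
  rcases max_cases (d 1 g + d m g) (d 1 (g ^ 2) + d 1 m) with h' | h' <;> linarith

/-- The powers of a long shortest conjugate form a coarse geodesic, uniformly. -/
theorem dist_pow_le_of_shortest (H : IsHyperbolicMetric d δ) {g : G} {τ : ℝ}
    (hτ : HasTranslationLength d g τ) (hL : 4 * δ + 2 < d 1 g)
    (hg : ∀ h, d 1 g ≤ d 1 (h⁻¹ * g * h)) (n : ℕ) : d 1 (g ^ n) ≤ n * τ + 4 * δ := by
  have hδ := H.nonneg_const
  have h1 := H.dist_sq_of_shortest hL hg
  refine H.dist_pow_le_of_superadditive hτ (by positivity) (fun m n hm hn => ?_) n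
  have := H.superadditive_of_dist_sq (g := g) (by linarith) m n hm hn
  linarith

theorem exists_shortest_conj (H : IsHyperbolicMetric d δ) (g : G) :
    ∃ k, ∀ h, d 1 (k⁻¹ * g * k) ≤ d 1 (h⁻¹ * (k⁻¹ * g * k) * h) := by
  choose f hf using fun k : G => H.exists_nat 1 (k⁻¹ * g * k)
  refine ⟨Function.argmin f, fun h => ?_⟩
  have h1 : f (Function.argmin f) ≤ f (Function.argmin f * h) := Function.argmin_le f _
  have h2 : h⁻¹ * ((Function.argmin f)⁻¹ * g * Function.argmin f) * h =
      (Function.argmin f * h)⁻¹ * g * (Function.argmin f * h) := by group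
  rw [h2, hf, hf]
  exact_mod_cast h1

/-- Some conjugate of an element of positive translation length moves the base point by little more
than that length, and so do all its powers. -/
theorem exists_conj_dist_pow_le (H : IsHyperbolicMetric d δ) {a : G} {τ : ℝ}
    (hτ : HasTranslationLength d a τ) (hpos : 0 < τ) :
    ∃ h, ∀ i : ℕ, d 1 ((h⁻¹ * a * h) ^ i) ≤ i * τ + 14 * δ := by
  have hδ := H.nonneg_const
  -- Every conjugate of `a ^ M` is long enough for `dist_pow_le_of_shortest`, so the conjugation is
  -- chosen to make `a ^ M`, rather than `a`, shortest.
  obtain ⟨M, hM⟩ := exists_nat_gt ((4 * δ + 2) / τ)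
  rw [div_lt_iff₀ hpos] at hM
  have hM0 : 0 < M := by
    rcases Nat.eq_zero_or_pos M with rfl | h
    · simp at hM; linarith
    · exact h
  obtain ⟨h, hh⟩ := H.exists_shortest_conj (a ^ M)
  have hb := H.translationLength_conj hτ h
  have e : h⁻¹ * a ^ M * h = (h⁻¹ * a * h) ^ M := by
    have := conj_pow (a := h⁻¹) (b := a) (i := M)
    rw [inv_inv] at this
    exact this.symm
  rw [e] at hh
  refine ⟨h, fun i => ?_⟩
  set b := h⁻¹ * a * h
  have hbM := H.mul_translationLength_le hb M
  have up : ∀ n : ℕ, d 1 (b ^ (M * n)) ≤ (M * n : ℕ) * τ + 4 * δ := fun n => by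
    have := H.dist_pow_le_of_shortest (hb.pow hM0) (by linarith) hh n
    rw [← pow_mul] at this
    push_cast
    linarith
  -- `T` is a multiple of `M`, so `b ^ T` is under control, and so large that the alternative with
  -- `d 1 (b ^ i)` twice fails in `f1`. Then `f1` bounds the displacements of `b ^ (T ± i)` by `(T ±
  -- i) τ + 9δ`, and `f2` yields the bound for `b ^ i`: `14 = 9 + 4 + 1`.
  obtain ⟨n, hn⟩ := exists_nat_gt ((d 1 (b ^ i) + i * τ + 10 * δ) / τ)
  rw [div_lt_iff₀ hpos] at hn
  set T := M * n
  have hTn : (n : ℝ) ≤ T := by exact_mod_cast Nat.le_mul_of_pos_left n hM0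
  have hdi := H.dist_nonneg 1 (b ^ i)
  have hiT : i ≤ T := by
    have : (i : ℝ) * τ < T * τ := by nlinarith
    exact_mod_cast (lt_of_mul_lt_mul_right this hpos.le).le
  have hT := up n
  have hTτ : d 1 (b ^ i) + i * τ + 10 * δ < T * τ := lt_of_lt_of_le hn (by gcongr)
  have lT := H.mul_translationLength_le hb T
  have lTi := H.mul_translationLength_le hb (T - i)
  have lTi' := H.mul_translationLength_le hb (T + i)
  have l2T := H.mul_translationLength_le hb (T + T)
  rw [Nat.cast_sub hiT] at lTi
  push_cast at lTi' l2T
  have f1 := H.four_point (b ^ 0) (b ^ (T + i)) (b ^ i) (b ^ T)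
  rw [H.dist_pow b (T + i) (by omega), H.dist_pow b (T - i) (by omega),
    H.dist_pow b i (by omega), H.dist_pow' b i (by omega),
    H.dist_pow b T (by omega), H.dist_pow' b T (by omega)] at f1
  have f2 := H.four_point (b ^ T) (b ^ (T + i)) (b ^ 0) (b ^ (T + T))
  rw [H.dist_pow b i (by omega), H.dist_pow b (T + T) (by omega),
    H.dist_pow' b T (by omega), H.dist_pow b (T - i) (by omega),
    H.dist_pow b T (by omega), H.dist_pow' b (T + i) (by omega)] at f2
  rcases max_cases (d 1 (b ^ i) + d 1 (b ^ i)) (d 1 (b ^ T) + d 1 (b ^ T)) with h | h <;>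
  rcases max_cases (d 1 (b ^ T) + d 1 (b ^ (T - i))) (d 1 (b ^ T) + d 1 (b ^ (T + i)))
    with h' | h' <;> nlinarith

/-- Elements of bounded displacement: doubling until the displacement grows. -/
theorem exists_dist_pow_le_of_dist_le (H : IsHyperbolicMetric d δ) {η : ℝ} (hη : 0 < η) {K : ℝ}
    (hK : 0 ≤ K) : ∃ c, 0 ≤ c ∧ ∀ (a : G) (τ : ℝ), HasTranslationLength d a τ → η ≤ τ → d 1 a ≤ K →
      ∀ n : ℕ, d 1 (a ^ n) ≤ n * τ + c := by
  have hδ := H.nonneg_const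
  obtain ⟨J, hJ⟩ : ∃ J : ℕ, K + 2 * δ * J < 2 ^ J * η := by
    have h1 : Tendsto (fun n : ℕ => (n : ℝ) ^ 1 / 2 ^ n) atTop (𝓝 0) :=
      tendsto_pow_const_div_const_pow_of_one_lt 1 (by norm_num)
    have h2 : Tendsto (fun n : ℕ => (n : ℝ) ^ 0 / 2 ^ n) atTop (𝓝 0) :=
      tendsto_pow_const_div_const_pow_of_one_lt 0 (by norm_num)
    have h3 := (h2.const_mul K).add (h1.const_mul (2 * δ))
    simp only [mul_zero, add_zero] at h3
    obtain ⟨J, hJ⟩ := (h3.eventually (gt_mem_nhds hη)).exists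
    refine ⟨J, ?_⟩
    have : (0 : ℝ) < 2 ^ J := by positivity
    field_simp at hJ
    simpa [mul_comm] using hJ
  refine ⟨2 * 2 ^ J * K, by positivity, fun a τ hτ hητ haK n => ?_⟩
  -- If each doubling added at most `2δ`, the displacement of `a ^ 2 ^ J` would be at most `K +
  -- 2δJ`, below its lower bound `2 ^ J * η`.
  obtain ⟨j, hj, hgrow⟩ : ∃ j < J, d 1 (a ^ 2 ^ j) + 2 * δ < d 1 (a ^ 2 ^ (j + 1)) := by
    by_contra! hcon
    have h1 : ∀ j ≤ J, d 1 (a ^ 2 ^ j) ≤ K + 2 * δ * j := by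
      intro j hj
      induction j with
      | zero => simpa using haK
      | succ j ih =>
        have h2 := ih (by omega)
        have h3 := hcon j (by omega)
        push_cast
        linarith
    have h2 := h1 J le_rfl
    have h3 := H.mul_translationLength_le hτ (2 ^ J)
    push_cast at h3
    have : (2 : ℝ) ^ J * η ≤ 2 ^ J * τ := by gcongr
    linarith
  have hlin : ∀ n : ℕ, d 1 (a ^ n) ≤ n * K := fun n => by
    have := H.dist_pow_mul_le a 1 n
    rw [one_mul, pow_one] at this
    exact this.trans (by gcongr)
  set q := 2 ^ j with hq
  have hq0 : 0 < q := by positivity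
  have hqJ : (q : ℝ) ≤ 2 ^ J := by
    rw [hq]; push_cast; exact pow_le_pow_right₀ (by norm_num) hj.le
  have hqK : (q : ℝ) * K ≤ 2 ^ J * K := by gcongr
  rw [pow_succ, pow_mul] at hgrow
  have hsub := H.dist_pow_add_le (a ^ q) 1 1
  rw [pow_one, one_add_one_eq_two] at hsub
  -- The superadditivity error for `a ^ q` is less than `d 1 (a ^ q) ≤ q * K`, and the remainder `n
  -- % q` costs at most another `q * K`.
  have h1 := H.dist_pow_le_of_superadditive (hτ.pow hq0) (by linarith)
    (H.superadditive_of_dist_sq hgrow) (n / q)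
  rw [← pow_mul] at h1
  have h2 := H.dist_pow_add_le a (q * (n / q)) (n % q)
  rw [Nat.div_add_mod] at h2
  have h3 : ((n % q : ℕ) : ℝ) * K ≤ q * K := by
    gcongr
    exact (Nat.mod_lt n hq0).le
  have h4 : ((n / q : ℕ) : ℝ) * (q * τ) ≤ n * τ := by
    have : ((n / q * q : ℕ) : ℝ) ≤ n := by exact_mod_cast Nat.div_mul_le_self n q
    push_cast at this
    nlinarith [H.translationLength_nonneg hτ]
  linarith [hlin (n % q), hlin q]

end IsHyperbolicMetric

end GroupGeometry

/-! ### Acylindricity and uniform lower bounds on translation lengths -/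

namespace GroupGeometry

variable {G : Type*} [Group G]

/-- Acylindricity as a pigeonhole principle: among more than `N` isometries that move two distant
points by at most `ε`, two coincide. -/
def IsAcylindricalMetric (d : G → G → ℝ) : Prop :=
  ∀ ε : ℝ, 0 ≤ ε → ∃ R : ℝ, ∃ N : ℕ, 0 < N ∧ ∀ z w : G, R ≤ d z w → ∀ F : ℕ → G,
    (∀ i ≤ N, d z (F i * z) ≤ ε ∧ d w (F i * w) ≤ ε) → ∃ i j, i < j ∧ j ≤ N ∧ F i = F j

theorem IsAcylindrical.isAcylindricalMetric {X : Set G} (h : IsAcylindrical X) :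
    IsAcylindricalMetric (fun g h : G => (wordDist X g h : ℝ)) := by
  intro ε hε
  obtain ⟨R, N, -, hN, H⟩ := h ε hε
  refine ⟨R, N, hN, fun z w hzw F hF => ?_⟩
  classical
  by_contra! hcon
  have hinj : Set.InjOn (fun i => z⁻¹ * F i * z) (Finset.range (N + 1) : Set ℕ) := by
    intro i hi j hj hij
    simp only [Finset.coe_range, Set.mem_Iio] at hi hj
    have hij' : F i = F j := by simpa using hij
    rcases lt_trichotomy i j with h | h | h
    · exact absurd hij' (hcon i j h (by omega))
    · exact h
    · exact absurd hij'.symm (hcon j i h (by omega))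
  have hsub : ((Finset.range (N + 1)).image (fun i => z⁻¹ * F i * z) : Set G) ⊆
      {f : G | (wordLength X f : ℝ) ≤ ε ∧
        (wordLength X ((z⁻¹ * w)⁻¹ * f * (z⁻¹ * w)) : ℝ) ≤ ε} := by
    intro f hf
    simp only [Finset.coe_image, Set.mem_image, Finset.coe_range, Set.mem_Iio] at hf
    obtain ⟨i, hi, rfl⟩ := hf
    obtain ⟨h1, h2⟩ := hF i (by omega)
    simp only [wordDist] at h1 h2
    refine ⟨by simpa [mul_assoc] using h1, ?_⟩
    have e : (z⁻¹ * w)⁻¹ * (z⁻¹ * F i * z) * (z⁻¹ * w) = w⁻¹ * (F i * w) := by group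
    rwa [e]
  have h1 := (Set.encard_le_encard hsub).trans (H (z⁻¹ * w) hzw)
  rw [Set.encard_coe_eq_coe_finsetCard, Finset.card_image_of_injOn hinj, Finset.card_range] at h1
  have : N + 1 ≤ N := by exact_mod_cast h1
  omega

namespace IsHyperbolicMetric

variable {d : G → G → ℝ} {δ : ℝ}

/-- **Bowditch's theorem**: positive translation lengths are bounded away from zero if the action is
acylindrical. -/
theorem exists_le_translationLength (H : IsHyperbolicMetric d δ) (hac : IsAcylindricalMetric d) :
    ∃ η : ℝ, 0 < η ∧ ∀ (a : G) (τ : ℝ), HasTranslationLength d a τ → 0 < τ → η ≤ τ := by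
  have hδ := H.nonneg_const
  obtain ⟨R, N, hN, hRN⟩ := hac (14 * δ + 1) (by positivity)
  have hN' : (0 : ℝ) < N := by exact_mod_cast hN
  -- If `N τ < 1`, then `b⁰, …, bᴺ` all move `1` and the distant point `bᵀ` by at most `14δ + 1`.
  -- Two of them coincide, which is impossible for positive translation length.
  refine ⟨1 / N, by positivity, fun a τ hτ hpos => ?_⟩
  by_contra! hlt
  rw [lt_div_iff₀ hN'] at hlt
  obtain ⟨h, hh⟩ := H.exists_conj_dist_pow_le hτ hpos
  have hb := H.translationLength_conj hτ h
  set b := h⁻¹ * a * h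
  obtain ⟨T, hT⟩ := exists_nat_gt (R / τ)
  rw [div_lt_iff₀ hpos] at hT
  have hsmall : ∀ i ≤ N, d 1 (b ^ i) ≤ 14 * δ + 1 := fun i hi => by
    have : (i : ℝ) ≤ N := by exact_mod_cast hi
    nlinarith [hh i]
  obtain ⟨i, j, hij, -, he⟩ := hRN 1 (b ^ T) (hT.le.trans (H.mul_translationLength_le hb T))
    (fun i => b ^ i) fun i hi => ⟨by simpa using hsmall i hi, by
      rw [← pow_add, H.dist_pow b i (by omega)]; exact hsmall i hi⟩
  have h1 : b ^ (j - i) = 1 := by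
    rw [pow_sub b hij.le]; simp [he]
  have h2 := H.mul_translationLength_le hb (j - i)
  rw [h1, H.self] at h2
  have h3 : (0 : ℝ) < (j - i : ℕ) := by exact_mod_cast Nat.sub_pos_of_lt hij
  nlinarith

/-- The powers of loxodromic elements that are shortest in their conjugacy classes form coarse
geodesics, with a uniform constant. -/
theorem exists_dist_pow_le (H : IsHyperbolicMetric d δ) {η : ℝ} (hη : 0 < η) :
    ∃ c, 0 ≤ c ∧ ∀ (a : G) (τ : ℝ), HasTranslationLength d a τ → η ≤ τ →
      (∀ h, d 1 a ≤ d 1 (h⁻¹ * a * h)) → ∀ n : ℕ, d 1 (a ^ n) ≤ n * τ + c := by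
  have hδ := H.nonneg_const
  obtain ⟨c, hc, h⟩ := H.exists_dist_pow_le_of_dist_le hη (K := 4 * δ + 2) (by positivity)
  refine ⟨c + 4 * δ, by positivity, fun a τ hτ hητ ha n => ?_⟩
  rcases le_or_gt (d 1 a) (4 * δ + 2) with h1 | h1
  · linarith [h a τ hτ hητ h1 n]
  · linarith [H.dist_pow_le_of_shortest hτ h1 ha n]

/-- A point between `p` and `q` is between nearby points `p'` and `q`, if it is far from `p`. -/
theorem between_of_near (H : IsHyperbolicMetric d δ) {p p' q w : G} {ρ E : ℝ}
    (hp : d p p' ≤ ρ) (hw : d p w + d w q ≤ d p q + E) (hfar : ρ + E + δ < d p w) :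
    d p' w + d w q ≤ d p' q + (E + δ) := by
  have h4 := H.four_point p q p' w
  rw [H.symm q w, H.symm q p'] at h4
  rcases max_cases (d p p' + d w q) (d p w + d p' q) with h | h <;>
    linarith [H.dist_nonneg p' w]

end IsHyperbolicMetric

/-! ### Coarse axes and their coordinates -/

/-- A coarse axis of the isometry `A`: a pair of functions (Busemann functions of the two ends of
the axis) that `A` shifts by `τ`.  The points of the axis are those where the sum of the functions
is small, and on the axis either function is a coarse coordinate. -/
structure CoarseAxis (d : G → G → ℝ) (A : G) (τ c : ℝ) (bm bp : G → ℝ) : Prop where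
  lip_left : ∀ z w, bm z ≤ bm w + d w z
  lip_right : ∀ z w, bp z ≤ bp w + d w z
  shift_left : ∀ z, bm (A * z) = bm z + τ
  shift_right : ∀ z, bp (A * z) = bp z - τ
  nonneg : ∀ z, 0 ≤ bm z + bp z
  dist_le : ∀ z w, d z w ≤ max (bm z + bp w) (bm w + bp z) + c

/-- The Busemann functions are infima over the orbit `x aᵐ` instead of limits, which makes the shift
by `τ` exact. The infima are attained up to `1 + c` at all orbit points far enough out, so the four
point condition with two such points gives `dist_le`, with constant `2(1 + c) + δ`. -/
theorem IsHyperbolicMetric.exists_coarseAxis {d : G → G → ℝ} {δ : ℝ} (H : IsHyperbolicMetric d δ)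
    {a : G} {τ c : ℝ} (hτ : HasTranslationLength d a τ)
    (ha : ∀ n : ℕ, d 1 (a ^ n) ≤ n * τ + c) (x : G) :
    ∃ bm bp : G → ℝ, CoarseAxis d (x * a * x⁻¹) τ (2 * c + δ + 2) bm bp ∧ bm x ≤ 0 ∧ bp x ≤ 0 := by
  set A := x * a * x⁻¹ with hA
  set s : ℤ → G := fun n => x * a ^ n with hs
  have hAs : ∀ n, A * s n = s (n + 1) := fun n => by
    rw [add_comm]; simp [hA, hs, zpow_add, mul_assoc]
  have hτ0 := H.translationLength_nonneg hτ
  have hd : ∀ m n : ℤ, m ≤ n → (n - m) * τ ≤ d (s m) (s n) ∧ d (s m) (s n) ≤ (n - m) * τ + c := by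
    intro m n hmn
    obtain ⟨k, rfl⟩ := Int.le.dest hmn
    have e : d (s m) (s (m + k)) = d 1 (a ^ k) := by
      have := H.mul_left (x * a ^ m) 1 (a ^ k)
      rw [← this]; simp [hs, zpow_add, mul_assoc]
    rw [e]
    push_cast
    have h1 := H.mul_translationLength_le hτ k
    have h2 := ha k
    constructor <;> linarith
  have hge : ∀ m n : ℤ, (n - m) * τ ≤ d (s m) (s n) := by
    intro m n
    rcases le_total m n with h | h
    · exact (hd m n h).1
    · have h1 : (m : ℝ) - n ≥ 0 := by rw [ge_iff_le, sub_nonneg]; exact_mod_cast h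
      nlinarith [H.dist_nonneg (s m) (s n)]
  have hbm : ∀ z, BddBelow (Set.range fun m : ℤ => d (s m) z + m * τ) := fun z => by
    refine ⟨- d (s 0) z, ?_⟩
    rintro _ ⟨m, rfl⟩
    have h1 := hge m 0
    simp only [Int.cast_zero] at h1
    linarith [H.triangle (s m) z (s 0), H.symm (s 0) z]
  have hbp : ∀ z, BddBelow (Set.range fun m : ℤ => d (s m) z - m * τ) := fun z => by
    refine ⟨- d (s 0) z, ?_⟩
    rintro _ ⟨m, rfl⟩
    have h1 := hge 0 m
    simp only [Int.cast_zero] at h1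
    linarith [H.triangle (s 0) z (s m), H.symm (s m) z]
  have hAd : ∀ m z, d (s (m + 1)) (A * z) = d (s m) z := fun m z => by rw [← hAs, H.mul_left]
  refine ⟨fun z => ⨅ m : ℤ, (d (s m) z + m * τ), fun z => ⨅ m : ℤ, (d (s m) z - m * τ),
    ⟨?_, ?_, ?_, ?_, ?_, ?_⟩, ?_, ?_⟩
  · intro z w
    rw [← sub_le_iff_le_add]
    refine le_ciInf fun m => ?_
    have := ciInf_le (hbm z) m
    linarith [H.triangle (s m) w z]
  · intro z w
    rw [← sub_le_iff_le_add]
    refine le_ciInf fun m => ?_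
    have := ciInf_le (hbp z) m
    linarith [H.triangle (s m) w z]
  · intro z
    rw [ciInf_add (hbm z), ← (Equiv.addRight (1 : ℤ)).iInf_comp]
    congr 1
    ext m
    simp only [Equiv.coe_addRight, hAd]
    push_cast
    ring
  · intro z
    rw [ciInf_sub (hbp z), ← (Equiv.addRight (1 : ℤ)).iInf_comp]
    congr 1
    ext m
    simp only [Equiv.coe_addRight, hAd]
    push_cast
    ring
  · intro z
    rw [← neg_le_iff_add_nonneg]
    refine le_ciInf fun m => ?_
    rw [neg_le]
    refine le_ciInf fun n => ?_
    linarith [hge m n, H.triangle (s m) z (s n), H.symm (s n) z]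
  · intro z w
    have evm : ∀ z, ∀ᶠ m : ℤ in atBot,
        d (s m) z + m * τ ≤ (⨅ m : ℤ, (d (s m) z + m * τ)) + 1 + c := by
      intro z
      obtain ⟨m, hm⟩ := exists_lt_of_ciInf_lt (lt_add_one (⨅ m : ℤ, (d (s m) z + m * τ)))
      filter_upwards [eventually_le_atBot m] with m' hm'
      linarith [H.triangle (s m') (s m) z, (hd m' m hm').2]
    have evp : ∀ z, ∀ᶠ m : ℤ in atTop,
        d (s m) z - m * τ ≤ (⨅ m : ℤ, (d (s m) z - m * τ)) + 1 + c := by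
      intro z
      obtain ⟨m, hm⟩ := exists_lt_of_ciInf_lt (lt_add_one (⨅ m : ℤ, (d (s m) z - m * τ)))
      filter_upwards [eventually_ge_atTop m] with m' hm'
      linarith [H.triangle (s m') (s m) z, (hd m m' hm').2, H.symm (s m') (s m)]
    obtain ⟨m, hmz, hmw⟩ := ((evm z).and (evm w)).exists
    obtain ⟨n, hnz, hnw⟩ := ((evp z).and (evp w)).exists
    set bmz := ⨅ m : ℤ, (d (s m) z + m * τ)
    set bmw := ⨅ m : ℤ, (d (s m) w + m * τ)
    set bpz := ⨅ m : ℤ, (d (s m) z - m * τ)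
    set bpw := ⨅ m : ℤ, (d (s m) w - m * τ)
    have h4 := H.four_point z w (s m) (s n)
    rw [H.symm z (s m), H.symm w (s n), H.symm z (s n), H.symm w (s m)] at h4
    have h5 := hge m n
    have h6 := le_max_left (bmz + bpw) (bmw + bpz)
    have h7 := le_max_right (bmz + bpw) (bmw + bpz)
    rcases max_cases (d (s m) z + d (s n) w) (d (s n) z + d (s m) w) with h | h <;> linarith
  · refine (ciInf_le (hbm x) 0).trans ?_
    simp [hs, H.self]
  · refine (ciInf_le (hbp x) 0).trans ?_
    simp [hs, H.self]

namespace CoarseAxis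

variable {d : G → G → ℝ} {δ : ℝ} {A : G} {τ c : ℝ} {bm bp : G → ℝ}

/-- Reversing the axis halves the case distinctions on direction below. -/
theorem flip (hA : CoarseAxis d A τ c bm bp) : CoarseAxis d A⁻¹ τ c bp bm where
  lip_left := hA.lip_right
  lip_right := hA.lip_left
  shift_left z := by have := hA.shift_right (A⁻¹ * z); rw [mul_inv_cancel_left] at this; linarith
  shift_right z := by have := hA.shift_left (A⁻¹ * z); rw [mul_inv_cancel_left] at this; linarith
  nonneg z := by rw [add_comm]; exact hA.nonneg z
  dist_le z w := by
    have := hA.dist_le z w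
    rwa [max_comm, add_comm (bm w), add_comm (bm z)] at this

theorem mono (hA : CoarseAxis d A τ c bm bp) {c' : ℝ} (h : c ≤ c') :
    CoarseAxis d A τ c' bm bp :=
  { hA with dist_le := fun z w => (hA.dist_le z w).trans (by linarith) }

theorem shift_left_zpow (hA : CoarseAxis d A τ c bm bp) (n : ℤ) (z : G) :
    bm (A ^ n * z) = bm z + n * τ := by
  induction n with
  | zero => simp
  | succ n ih =>
    rw [add_comm, zpow_add, zpow_one, mul_assoc, hA.shift_left, ih]; push_cast; ring
  | pred n ih =>
    have := hA.shift_left (A ^ (-(n : ℤ) - 1) * z)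
    rw [← mul_assoc, ← zpow_one_add, add_sub_cancel, ih] at this
    push_cast at this ⊢
    linarith

theorem shift_right_zpow (hA : CoarseAxis d A τ c bm bp) (n : ℤ) (z : G) :
    bp (A ^ n * z) = bp z - n * τ := by
  have := hA.flip.shift_left_zpow (-n) z
  rw [inv_zpow', neg_neg] at this
  rw [this]; push_cast; ring

/-- The alternatives say that `q` is ahead of or behind `p`. Only `p` has to be near the axis. -/
theorem orientation (hA : CoarseAxis d A τ c bm bp) {p q : G} {E : ℝ} (hp : bm p + bp p ≤ E) :
    d p q ≤ bm q - bm p + (E + c) ∨ d p q ≤ bp q - bp p + (E + c) := by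
  have h := hA.dist_le p q
  rcases max_cases (bm p + bp q) (bm q + bp p) with h' | h'
  · right; linarith
  · left; linarith

theorem dist_le_of_le (hA : CoarseAxis d A τ c bm bp) {p q : G} {E : ℝ} (hp : bm p + bp p ≤ E)
    (hq : bm q + bp q ≤ E) : d p q ≤ |bm q - bm p| + (E + c) := by
  have h := hA.dist_le p q
  have h1 := le_abs_self (bm q - bm p)
  have h2 := neg_abs_le (bm q - bm p)
  rcases max_cases (bm p + bp q) (bm q + bp p) with h' | h' <;> linarith

/-- A point between two points of the axis is near the axis, and its coordinate is determined by
its distances from these points. -/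
theorem of_between (hA : CoarseAxis d A τ c bm bp) {p q w : G} {D E E' : ℝ}
    (hpq : d p q ≤ bm q - bm p + D) (hq : bm q + bp q ≤ E)
    (hw : d p w + d w q ≤ d p q + E') (hsymm : d q w = d w q) :
    bm w + bp w ≤ D + E + E' ∧ bm p + d p w ≤ bm w + (D + E + E') := by
  have h1 := hA.lip_left w p
  have h2 := hA.lip_right w q
  have h3 := hA.nonneg w
  constructor <;> linarith

/-- A point near the axis is between two points of the axis if its coordinate is between theirs. -/
theorem between (hA : CoarseAxis d A τ c bm bp) {p q w : G} {E : ℝ} (hp : bm p + bp p ≤ E)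
    (hq : bm q + bp q ≤ E) (hw : bm w + bp w ≤ E) (hpw : bm p ≤ bm w) (hwq : bm w ≤ bm q) :
    d p w + d w q ≤ d p q + (2 * E + 2 * c) := by
  have h1 := hA.dist_le_of_le hp hw
  have h2 := hA.dist_le_of_le hw hq
  rw [abs_of_nonneg (by linarith)] at h1 h2
  have h3 := hA.lip_left q p
  linarith

/-- Near a segment `[p, q]` of both axes the coordinates with respect to the axes agree. -/
theorem synchronize {B : G} {τ' : ℝ} {bm' bp' : G → ℝ} (H : IsHyperbolicMetric d δ)
    (hA : CoarseAxis d A τ c bm bp) (hB : CoarseAxis d B τ' c bm' bp') {p q w : G} {D E : ℝ}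
    (hD : 0 ≤ D) (hE : 0 ≤ E) (hc : 0 ≤ c) (hp : bm p + bp p ≤ E) (hq : bm q + bp q ≤ E)
    (hq' : bm' q + bp' q ≤ E) (hpq : d p q ≤ bm' q - bm' p + D) (hw : bm w + bp w ≤ E)
    (hpw : bm p ≤ bm w) (hwq : bm w ≤ bm q) :
    bm' w + bp' w ≤ D + 3 * E + 2 * c ∧
      |(bm' w - bm' p) - (bm w - bm p)| ≤ D + 3 * E + 2 * c := by
  obtain ⟨h1, h2⟩ := hB.of_between hpq hq' (hA.between hp hq hw hpw hwq) (H.symm _ _)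
  have h3 := hA.dist_le_of_le hp hw
  rw [abs_of_nonneg (by linarith)] at h3
  have h4 := hA.lip_left w p
  have h5 := hB.lip_left w p
  refine ⟨by linarith, ?_⟩
  rw [abs_le]
  constructor <;> linarith

/-- A segment whose ends are close to an axis is itself near the axis, away from its ends. -/
theorem add_le_of_near (hA : CoarseAxis d A τ c bm bp) (H : IsHyperbolicMetric d δ)
    {p q p' q' w : G} {ρ E : ℝ} (hp' : bm p' + bp p' ≤ c) (hq' : bm q' + bp q' ≤ c)
    (hp : d p p' ≤ ρ) (hq : d q q' ≤ ρ) (hw : d p w + d w q ≤ d p q + E)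
    (hpw : ρ + E + 2 * δ < d p w) (hqw : ρ + E + 2 * δ < d q w) :
    bm w + bp w ≤ 3 * c + E + 2 * δ := by
  have hδ := H.nonneg_const
  -- The ends are replaced by points of the axis one after the other. Each replacement adds `δ` to
  -- the error, so the second needs `2δ` in the distance condition.
  have h1 := H.between_of_near hp hw (by linarith)
  have h2 := H.between_of_near (w := w) (q := p') (E := E + δ) hq
    (by linarith [H.symm q w, H.symm w p', H.symm q p']) (by linarith)
  have h3 : d p' w + d w q' ≤ d p' q' + (E + δ + δ) := by
    linarith [H.symm q' w, H.symm w p', H.symm q' p']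
  rcases hA.orientation (q := q') hp' with h | h
  · have := (hA.of_between h hq' h3 (H.symm _ _)).1
    linarith
  · have := (hA.flip.of_between (E := c) h (by linarith) h3 (H.symm _ _)).1
    linarith

end CoarseAxis

end GroupGeometry

/-! ### Two pigeonhole arguments: a commuting power, then a common power -/

namespace GroupGeometry

variable {G : Type*} [Group G]

namespace IsHyperbolicMetric

variable {d : G → G → ℝ} {δ : ℝ}

/-- If the axes of `A` and `B` have a long segment in common, then a power of `A` commutes
with `B`. -/
theorem exists_commute_pow_of_oriented (H : IsHyperbolicMetric d δ) (hac : IsAcylindricalMetric d)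
    {η c : ℝ} (hη : 0 < η) (hc : 0 ≤ c) :
    ∃ C : ℕ, ∀ (A B : G) (τ τ' : ℝ) (am ap bm bp : G → ℝ), CoarseAxis d A τ c am ap →
      CoarseAxis d B τ' c bm bp → η ≤ τ → 0 ≤ τ' → τ' ≤ τ + c → ∀ (p : G) (n : ℕ), C ≤ n →
      am p + ap p ≤ c → bm p + bp p ≤ c → bm (A ^ n * p) + bp (A ^ n * p) ≤ c →
      d p (A ^ n * p) ≤ bm (A ^ n * p) - bm p + 2 * c → ∃ m : ℕ, 0 < m ∧ Commute (A ^ m) B := by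
  obtain ⟨R, N, hN, hRN⟩ := hac (90 * c) (by positivity)
  obtain ⟨n₂, hn₂⟩ := exists_nat_gt (R / η)
  obtain ⟨n₃, hn₃⟩ := exists_nat_gt (20 * c / η)
  rw [div_lt_iff₀ hη] at hn₂ hn₃
  -- The middle `n₂` periods are longer than `R`. The initial margin leaves room for `A⁻ⁱ` with `i ≤
  -- N`, for `B⁻¹` (one period, as `τ' ≤ τ + c`) and for the errors; backward moves need only the
  -- error margin `n₃` at the other end.
  refine ⟨(N + 1 + n₃) + n₂ + n₃, ?_⟩
  intro A B τ τ' am ap bm bp hA hB hητ hτ' hττ p n hn hpA hpB hqB hor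
  have hτ : 0 < τ := hη.trans_le hητ
  have sA : ∀ (i : ℕ) z, am (A ^ i * z) = am z + i * τ := fun i z => by
    simpa using hA.shift_left_zpow i z
  have sA' : ∀ (i : ℕ) z, ap (A ^ i * z) = ap z - i * τ := fun i z => by
    simpa using hA.shift_right_zpow i z
  have tA : ∀ (i : ℕ) z, am ((A ^ i)⁻¹ * z) = am z - i * τ := fun i z => by
    have := sA i ((A ^ i)⁻¹ * z); rw [mul_inv_cancel_left] at this; linarith
  have tA' : ∀ (i : ℕ) z, ap ((A ^ i)⁻¹ * z) = ap z + i * τ := fun i z => by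
    have := sA' i ((A ^ i)⁻¹ * z); rw [mul_inv_cancel_left] at this; linarith
  have tB : ∀ z, bm (B⁻¹ * z) = bm z - τ' := hB.flip.shift_right
  have tB' : ∀ z, bp (B⁻¹ * z) = bp z + τ' := hB.flip.shift_left
  set q := A ^ n * p with hq
  have hqA : am q + ap q ≤ c := by rw [hq, sA, sA']; linarith
  have hamq : am q = am p + n * τ := sA n p
  have hle : am q - am p ≤ d p q := by
    have := hA.lip_left q p; linarith
  have horA : d p q ≤ am q - am p + 2 * c := by
    have h := hA.dist_le_of_le hpA hqA
    rw [abs_of_nonneg (by rw [hamq]; have : 0 ≤ n * τ := by positivity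
                          linarith)] at h
    linarith
  have hnn : ((N + 1 + n₃ + n₂ + n₃ : ℕ) : ℝ) * τ ≤ n * τ := by
    gcongr
  push_cast at hnn
  have hn₃τ : 20 * c < n₃ * τ := hn₃.trans_le (by gcongr)
  have hn₂τ : R < n₂ * τ := hn₂.trans_le (by gcongr)
  have hNτ : 0 ≤ N * τ := by positivity
  have toB : ∀ w, am w + ap w ≤ c → am p ≤ am w → am w ≤ am q →
      bm w + bp w ≤ 7 * c ∧ |(bm w - bm p) - (am w - am p)| ≤ 7 * c := fun w h1 h2 h3 => by
    have := hA.synchronize H hB (D := 2 * c) (by positivity) hc hc hpA hqA hqB hor h1 h2 h3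
    rwa [show 2 * c + 3 * c + 2 * c = 7 * c by ring] at this
  have toA : ∀ w, bm w + bp w ≤ 7 * c → bm p ≤ bm w → bm w ≤ bm q →
      am w + ap w ≤ 25 * c ∧ |(am w - am p) - (bm w - bm p)| ≤ 25 * c := fun w h1 h2 h3 => by
    have := hB.synchronize H hA (D := 2 * c) (E := 7 * c) (by positivity) (by positivity) hc
      (by linarith) (by linarith) (by linarith) horA h1 h2 h3
    rwa [show 2 * c + 3 * (7 * c) + 2 * c = 25 * c by ring] at this
  -- The displacement is the distance from `B⁻¹ A⁻ⁱ z` to `A⁻ⁱ B⁻¹ z`. Passing to the coordinate of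
  -- `B` and back costs `7c + 25c` for each point, so their coordinates differ by at most `64c`;
  -- adding `25c + c` for the distance to the axis gives `90c`.
  have move : ∀ (j : ℕ), N + 1 + n₃ ≤ j → j ≤ N + 1 + n₃ + n₂ → ∀ i ≤ N,
      d (A ^ j * p) ((A ^ i * B * (A ^ i)⁻¹ * B⁻¹) * (A ^ j * p)) ≤ 90 * c := by
    intro j hj1 hj2 i hi
    have hj1' : ((N + 1 + n₃ : ℕ) : ℝ) * τ ≤ j * τ := by gcongr
    have hj2' : j * τ ≤ ((N + 1 + n₃ + n₂ : ℕ) : ℝ) * τ := by gcongr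
    have hi' : (i : ℝ) * τ ≤ N * τ := by gcongr
    have hi0 : 0 ≤ (i : ℝ) * τ := by positivity
    push_cast at hj1' hj2'
    set z := A ^ j * p
    have hz : am z = am p + j * τ := sA j p
    have hz' : am z + ap z ≤ c := by rw [sA, sA']; linarith
    have hz₂ : am ((A ^ i)⁻¹ * z) + ap ((A ^ i)⁻¹ * z) ≤ c := by rw [tA, tA']; linarith
    obtain ⟨e₁, k₁⟩ := toB z hz' (by linarith) (by linarith)
    obtain ⟨e₂, k₂⟩ := toB ((A ^ i)⁻¹ * z) hz₂ (by rw [tA]; linarith) (by rw [tA]; linarith)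
    rw [tA] at k₂
    rw [abs_le] at k₁ k₂
    obtain ⟨e₃, k₃⟩ := toA (B⁻¹ * z) (by rw [tB, tB']; linarith) (by rw [tB]; linarith)
      (by rw [tB]; linarith)
    obtain ⟨e₄, k₄⟩ := toA (B⁻¹ * ((A ^ i)⁻¹ * z)) (by rw [tB, tB']; linarith)
      (by rw [tB]; linarith) (by rw [tB]; linarith)
    rw [tB] at k₃ k₄
    rw [abs_le] at k₃ k₄
    have h1 := hA.dist_le_of_le (p := B⁻¹ * ((A ^ i)⁻¹ * z)) (q := (A ^ i)⁻¹ * (B⁻¹ * z)) e₄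
      (by rw [tA, tA']; linarith)
    rw [tA] at h1
    have h2 : d z ((A ^ i * B * (A ^ i)⁻¹ * B⁻¹) * z) =
        d (B⁻¹ * ((A ^ i)⁻¹ * z)) ((A ^ i)⁻¹ * (B⁻¹ * z)) := by
      rw [← H.mul_left (B⁻¹ * (A ^ i)⁻¹) z]; simp [mul_assoc]
    rw [h2]
    refine h1.trans ?_
    have h3 : |am (B⁻¹ * z) - i * τ - am (B⁻¹ * ((A ^ i)⁻¹ * z))| ≤ 64 * c := by
      rw [abs_le]; constructor <;> linarith
    linarith
  have hfar : R ≤ d (A ^ (N + 1 + n₃) * p) (A ^ (N + 1 + n₃ + n₂) * p) := by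
    have h1 := hA.lip_left (A ^ (N + 1 + n₃ + n₂) * p) (A ^ (N + 1 + n₃) * p)
    rw [sA, sA] at h1
    push_cast at h1
    linarith
  obtain ⟨i, j, hij, -, he⟩ := hRN _ _ hfar (fun i => A ^ i * B * (A ^ i)⁻¹ * B⁻¹) fun i hi =>
    ⟨move _ le_rfl (by omega) i hi, move _ (by omega) le_rfl i hi⟩
  obtain ⟨m, rfl⟩ := Nat.exists_eq_add_of_lt hij
  refine ⟨m + 1, by omega, ?_⟩
  rw [add_assoc] at he
  have h1 := congrArg (fun g => (A ^ i)⁻¹ * g * B * A ^ i) he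
  simp only [pow_add A i, mul_inv_rev] at h1
  have h2 : B = A ^ (m + 1) * B * (A ^ (m + 1))⁻¹ := by simpa [mul_assoc] using h1
  exact (eq_mul_inv_iff_mul_eq.1 h2).symm

/-- If the axes of `A` and `B` have a long segment in common, then a power of `A` commutes
with `B`. -/
theorem exists_commute_pow (H : IsHyperbolicMetric d δ) (hac : IsAcylindricalMetric d)
    {η c : ℝ} (hη : 0 < η) (hc : 0 ≤ c) :
    ∃ C : ℕ, ∀ (A B : G) (τ τ' : ℝ) (am ap bm bp : G → ℝ), CoarseAxis d A τ c am ap →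
      CoarseAxis d B τ' c bm bp → η ≤ τ → 0 ≤ τ' → τ' ≤ τ + c → ∀ (p : G) (n : ℕ), C ≤ n →
      am p + ap p ≤ c → bm p + bp p ≤ c → bm (A ^ n * p) + bp (A ^ n * p) ≤ c →
      ∃ m : ℕ, 0 < m ∧ Commute (A ^ m) B := by
  obtain ⟨C, hC⟩ := H.exists_commute_pow_of_oriented hac hη hc
  refine ⟨C, fun A B τ τ' am ap bm bp hA hB hητ hτ' hττ p n hn hpA hpB hqB => ?_⟩
  rcases hB.orientation (q := A ^ n * p) hpB with h | h
  · exact hC A B τ τ' am ap bm bp hA hB hητ hτ' hττ p n hn hpA hpB hqB (by linarith)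
  -- The axes run in opposite directions, so `B` is replaced by its inverse.
  · obtain ⟨m, hm, hmB⟩ := hC A B⁻¹ τ τ' am ap bp bm hA hB.flip hητ hτ' hττ p n hn hpA
      (by linarith) (by linarith) (by linarith)
    exact ⟨m, hm, Commute.inv_right_iff.1 hmB⟩

/-- If a power of `A`, an isometry with an axis, commutes with `B`, then `A` and `B` have a common
power. -/
theorem exists_zpow_eq_of_commute (H : IsHyperbolicMetric d δ) (hac : IsAcylindricalMetric d)
    {A B : G} {τ c : ℝ} {am ap : G → ℝ} (hA : CoarseAxis d A τ c am ap) (hτ : 0 < τ) (hc : 0 ≤ c)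
    {x : G} (hx : am x + ap x ≤ c) {m : ℕ} (hm : 0 < m) (hAB : Commute (A ^ m) B)
    (hB : ¬ IsOfFinOrder B) : ∃ s t : ℤ, s ≠ 0 ∧ t ≠ 0 ∧ B ^ s = A ^ t := by
  have hδ := H.nonneg_const
  set D := A ^ m with hD
  set σ := m * τ with hσ
  have hσ0 : 0 < σ := mul_pos (by exact_mod_cast hm) hτ
  have sD : ∀ (i : ℤ) z, am (D ^ i * z) = am z + i * σ := fun i z => by
    have := hA.shift_left_zpow (m * i) z
    rw [zpow_mul, zpow_natCast] at this
    rw [hD, this, hσ]; push_cast; ring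
  have sD' : ∀ (i : ℤ) z, ap (D ^ i * z) = ap z - i * σ := fun i z => by
    have := hA.shift_right_zpow (m * i) z
    rw [zpow_mul, zpow_natCast] at this
    rw [hD, this, hσ]; push_cast; ring
  -- The points `Dⁱ f x = f Dⁱ x` form a coarse geodesic at distance at most `d x (f x)` from points
  -- of the axis. Far from its ends it is near the axis with a bound independent of `f`.
  have near : ∀ f : G, Commute D f → am (f * x) + ap (f * x) ≤ 7 * c + 2 * δ := by
    intro f hf
    set w := f * x
    obtain ⟨t, ht⟩ := exists_nat_gt ((d x w + 4 * c + 2 * δ) / σ)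
    rw [div_lt_iff₀ hσ0] at ht
    have e : ∀ i : ℤ, D ^ i * w = f * (D ^ i * x) := fun i => by
      rw [← mul_assoc, ← mul_assoc, (hf.zpow_left i).eq]
    have lo : ∀ i j : ℤ, (j - i) * σ ≤ d (D ^ i * w) (D ^ j * w) := fun i j => by
      have h := hA.lip_left (D ^ j * x) (D ^ i * x)
      rw [e, e, H.mul_left]
      rw [sD, sD] at h
      linarith
    have up : ∀ i j : ℤ, i ≤ j → d (D ^ i * w) (D ^ j * w) ≤ (j - i) * σ + 2 * c := by
      intro i j hij
      have hij' : (i : ℝ) ≤ j := by exact_mod_cast hij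
      have h := hA.dist_le_of_le (p := D ^ i * x) (q := D ^ j * x) (E := c)
        (by rw [sD, sD']; linarith) (by rw [sD, sD']; linarith)
      rw [e, e, H.mul_left]
      rw [sD, sD, abs_of_nonneg (by nlinarith)] at h
      linarith
    have h0 : D ^ (0 : ℤ) * w = w := by simp
    have u1 := up (-t) 0 (by omega)
    have u2 := up 0 t (by omega)
    have l1 := lo (-t) 0
    have l2 := lo 0 t
    have l3 := lo (-t) t
    rw [h0] at u1 u2 l1 l2
    push_cast at u1 u2 l1 l2 l3
    have := hA.add_le_of_near H (p := D ^ (-(t : ℤ)) * w) (q := D ^ (t : ℤ) * w)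
      (p' := D ^ (-(t : ℤ)) * x) (q' := D ^ (t : ℤ) * x) (w := w) (ρ := d x w) (E := 4 * c)
      (by rw [sD, sD']; linarith) (by rw [sD, sD']; linarith)
      (by rw [H.mul_left, H.symm]) (by rw [H.mul_left, H.symm]) (by linarith) (by linarith)
      (by linarith [H.symm w (D ^ (t : ℤ) * w)])
    linarith
  have comB : ∀ j : ℕ, Commute D (B ^ j) := fun j => hAB.pow_right j
  -- `D⁻ⁱ` brings `Bʲ x` back to within one translation length of `x` along the axis.
  have hfloor : ∀ j : ℕ, ∃ i : ℤ, 0 ≤ am (B ^ j * x) - am x - i * σ ∧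
      am (B ^ j * x) - am x - i * σ ≤ σ := by
    intro j
    refine ⟨⌊(am (B ^ j * x) - am x) / σ⌋, ?_, ?_⟩
    · have := Int.floor_le ((am (B ^ j * x) - am x) / σ)
      rw [le_div_iff₀ hσ0] at this
      linarith
    · have := (Int.lt_floor_add_one ((am (B ^ j * x) - am x) / σ)).le
      rw [div_le_iff₀ hσ0] at this
      linarith
  choose i hi0 hi1 using hfloor
  obtain ⟨R, N, hN, hRN⟩ := hac (σ + (7 * c + 2 * δ + c)) (by positivity)
  obtain ⟨t, ht⟩ := exists_nat_gt (R / σ)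
  rw [div_lt_iff₀ hσ0] at ht
  have hfar : R ≤ d x (D ^ (t : ℤ) * x) := by
    have h := hA.lip_left (D ^ (t : ℤ) * x) x
    rw [sD] at h
    push_cast at h
    linarith
  have comF : ∀ j, Commute D (D ^ (-i j) * B ^ j) := fun j =>
    ((Commute.refl D).zpow_right _).mul_right (comB j)
  have hmove : ∀ j, d x ((D ^ (-i j) * B ^ j) * x) ≤ σ + (7 * c + 2 * δ + c) := by
    intro j
    refine (hA.dist_le_of_le (E := 7 * c + 2 * δ) (by linarith) (near _ (comF j))).trans ?_
    gcongr
    rw [mul_assoc, sD, abs_le]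
    have h1 := hi0 j
    have h2 := hi1 j
    push_cast
    constructor <;> linarith
  -- These elements commute with `D`, so they move `Dᵗ x` exactly as far as `x`.
  obtain ⟨j, k, hjk, -, he⟩ := hRN _ _ hfar (fun j => D ^ (-i j) * B ^ j) fun j _ =>
    ⟨hmove j, by
      rw [← mul_assoc, ← ((comF j).zpow_left t).eq, mul_assoc, H.mul_left]; exact hmove j⟩
  have hpow : B ^ ((k : ℤ) - j) = A ^ ((m : ℤ) * (i k - i j)) := by
    have h1 : B ^ k * (B ^ j)⁻¹ = D ^ (i k) * (D ^ (i j))⁻¹ := by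
      simp only [zpow_neg] at he
      have h2 : B ^ k = D ^ (i k) * ((D ^ (i j))⁻¹ * B ^ j) := by rw [he]; simp
      rw [h2]; simp [mul_assoc]
    rw [zpow_sub, zpow_natCast, zpow_natCast, h1, zpow_mul, zpow_natCast, ← hD, zpow_sub]
  refine ⟨k - j, m * (i k - i j), by omega, fun h0 => ?_, hpow⟩
  rw [h0, zpow_zero] at hpow
  refine hB (isOfFinOrder_iff_zpow_eq_one.2 ⟨_, ?_, hpow⟩)
  omega

end IsHyperbolicMetric

end GroupGeometry

/-! ### Application to word metrics and periodic paths -/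

namespace GroupGeometry

variable {G : Type*} [Group G] {X : Set G}

theorem hasTranslationLength_stableNorm (hsymm : ∀ s ∈ X, s⁻¹ ∈ X)
    (hgen : Subgroup.closure X = ⊤) (g : G) :
    HasTranslationLength (fun g h : G => (wordDist X g h : ℝ)) g (stableNorm X g) := by
  simpa [HasTranslationLength, wordDist] using tendsto_stableNorm X hsymm hgen g

/-- Dividing the lower quasi-isometry bound by `n` gives `τ ≥ 1 / l`. The orbit of `x` is measured
by the powers of `x⁻¹ g x`, which has the same translation length as `g`. -/
theorem IsLoxodromic.translationLength_pos {δ τ : ℝ} {g : G}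
    (H : IsHyperbolicMetric (fun g h : G => (wordDist X g h : ℝ)) δ) (hg : IsLoxodromic X g)
    (hτ : HasTranslationLength (fun g h : G => (wordDist X g h : ℝ)) g τ) : 0 < τ := by
  obtain ⟨x, l, c, hl, -, hx⟩ := hg
  have hl0 : 0 < l := by linarith
  have h0 : Tendsto (fun n : ℕ => 1 / l - c / (n : ℝ)) atTop (𝓝 (1 / l)) := by
    simpa using tendsto_const_nhds.sub (tendsto_const_div_atTop_nhds_zero_nat c)
  refine lt_of_lt_of_le (by positivity : 0 < 1 / l)
    (le_of_tendsto_of_tendsto h0 (H.translationLength_conj hτ x) ?_)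
  filter_upwards [eventually_ge_atTop 1] with n hn
  have hn' : (0 : ℝ) < n := by exact_mod_cast hn
  have h1 := (hx 0 n).1
  have e : (wordDist X 1 ((x⁻¹ * g * x) ^ n) : ℝ) = wordDist X (g ^ (0 : ℤ) * x) (g ^ (n : ℤ) * x) := by
    have := conj_pow (a := x⁻¹) (b := g) (i := n)
    rw [inv_inv] at this
    rw [this]
    simpa using H.dist_one_conj (g ^ n) x
  rw [← e] at h1
  have h2 : |((0 : ℤ) : ℝ) - (n : ℤ)| = n := by simp
  rw [h2] at h1
  rw [le_div_iff₀ hn']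
  refine le_trans (le_of_eq ?_) h1
  field_simp

theorem IsHyperbolicMetric.not_isOfFinOrder {d : G → G → ℝ} {δ τ : ℝ} {g : G}
    (H : IsHyperbolicMetric d δ) (hτ : HasTranslationLength d g τ) (hpos : 0 < τ) :
    ¬ IsOfFinOrder g := by
  intro h
  obtain ⟨n, hn, hgn⟩ := isOfFinOrder_iff_pow_eq_one.1 h
  have h1 := H.mul_translationLength_le hτ n
  rw [hgn, H.self] at h1
  have : (0 : ℝ) < n := by exact_mod_cast hn
  nlinarith

/-- The vertices of the path `L(y, b)` are near the axis of `y b y⁻¹`. -/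
theorem CoarseAxis.add_periodicPath_le {δ τ c : ℝ} {b y : G} {v : List G} {bm bp : G → ℝ}
    (H : IsHyperbolicMetric (fun g h : G => (wordDist X g h : ℝ)) δ)
    (hB : CoarseAxis (fun g h : G => (wordDist X g h : ℝ)) (y * b * y⁻¹) τ c bm bp)
    (hv : IsShortestWordFor X v b) (hym : bm y ≤ 0) (hyp : bp y ≤ 0) (j : ℤ) :
    bm (periodicPath y v j) + bp (periodicPath y v j) ≤ wordLength X b - τ := by
  obtain ⟨⟨hvX, hvb⟩, hvl⟩ := hv
  unfold periodicPath
  rw [hvb]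
  set m := j / (v.length : ℤ)
  set k := (j % (v.length : ℤ)).toNat
  have e : ∀ i : ℤ, y * b ^ i = (y * b * y⁻¹) ^ i * y := fun i => by
    rw [conj_zpow]; simp
  have h1 : wordDist X (y * b ^ m * (v.take k).prod) (y * b ^ m) ≤ (v.take k).length := by
    have h := H.symm (y * b ^ m * (v.take k).prod) (y * b ^ m)
    have h' : wordDist X (y * b ^ m * (v.take k).prod) (y * b ^ m) =
      wordDist X (y * b ^ m) (y * b ^ m * (v.take k).prod) := by exact_mod_cast h
    rw [h', wordDist, inv_mul_cancel_left]
    exact wordLength_le ⟨fun s hs => hvX s (List.mem_of_mem_take hs), rfl⟩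
  have h2 : wordDist X (y * b ^ m * (v.take k).prod) (y * b ^ (m + 1)) ≤ (v.drop k).length := by
    rw [wordDist]
    refine wordLength_le ⟨fun s hs => hvX s (List.mem_of_mem_drop hs), ?_⟩
    rw [eq_inv_mul_iff_mul_eq, mul_assoc, List.prod_take_mul_prod_drop, hvb, mul_assoc,
      zpow_add_one]
  have h3 : (v.take k).length + (v.drop k).length = wordLength X b := by
    rw [← List.length_append, List.take_append_drop, hvl]
  -- `bm` is estimated from the phase vertex before and `bp` from the one after: the two distances
  -- add up to at most `|b|`, and the shifts `m τ` and `-(m + 1) τ` leave `-τ`.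
  have h4 := hB.lip_left (y * b ^ m * (v.take k).prod) (y * b ^ m)
  have h5 := hB.lip_right (y * b ^ m * (v.take k).prod) (y * b ^ (m + 1))
  rw [e m, hB.shift_left_zpow] at h4
  rw [e (m + 1), hB.shift_right_zpow] at h5
  rw [← e m] at h4
  rw [← e (m + 1)] at h5
  have h1' : (wordDist X (y * b ^ m * (v.take k).prod) (y * b ^ m) : ℝ) +
      wordDist X (y * b ^ m * (v.take k).prod) (y * b ^ (m + 1)) ≤ wordLength X b := by
    exact_mod_cast (by omega)
  have h6 := H.symm (y * b ^ m) (y * b ^ m * (v.take k).prod)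
  have h7 := H.symm (y * b ^ (m + 1)) (y * b ^ m * (v.take k).prod)
  push_cast at h5
  linarith

theorem periodicPath_mul_length {u : List G} (hu : u.length ≠ 0) (x : G) (n : ℤ) :
    periodicPath x u (n * u.length) = x * u.prod ^ n := by
  have : (u.length : ℤ) ≠ 0 := by exact_mod_cast hu
  simp [periodicPath, Int.mul_ediv_cancel _ this]

/-- The geometric core of the periodicity theorem: if the ends of a sufficiently long orbit segment
of `x a x⁻¹` are near the axis of `B`, then the axes have a long segment in common. -/
theorem IsHyperbolicMetric.exists_zpow_eq_of_near {d : G → G → ℝ} {δ : ℝ}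
    (H : IsHyperbolicMetric d δ) (hac : IsAcylindricalMetric d) {η c : ℝ} (hη : 0 < η)
    (hc : 0 ≤ c) :
    ∃ C : ℝ, 0 < C ∧ ∀ (a b x y y₀ y₁ : G) (τ τ' ι : ℝ) (bm bp : G → ℝ),
      HasTranslationLength d a τ → (∀ n : ℕ, d 1 (a ^ n) ≤ n * τ + c) →
      HasTranslationLength d b τ' → ¬ IsOfFinOrder b →
      CoarseAxis d (y * b * y⁻¹) τ' (2 * c + δ + 2) bm bp →
      bm y₀ + bp y₀ ≤ c → bm y₁ + bp y₁ ≤ c → η ≤ ι → ι ≤ τ → d 1 b ≤ d 1 a →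
      ∀ r k : ℕ, 2 * (r : ℝ) / ι + C ≤ k → d x y₀ ≤ r → d (x * a ^ k) y₁ ≤ r →
      ∃ s t : ℤ, s ≠ 0 ∧ t ≠ 0 ∧ (y * b * y⁻¹) ^ s = (x * a * x⁻¹) ^ t := by
  have hδ := H.nonneg_const
  set c₁ := 2 * c + δ + 2 with hc₁
  set c₂ := 5 * c₁ + 4 * δ with hc₂
  have hc₂0 : 0 ≤ c₂ := by positivity
  obtain ⟨C, hC⟩ := H.exists_commute_pow hac hη hc₂0
  set κ := 2 * c + 2 * δ with hκ
  have hκ0 : 0 ≤ κ := by positivity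
  refine ⟨2 * (κ / η) + 2 + C, by positivity, ?_⟩
  intro a b x y y₀ y₁ τ τ' ι bm bp hτ ha hτ' hb hB hy₀ hy₁ hηι hιτ hba r k hk hxr hkr
  have hι : 0 < ι := hη.trans_le hηι
  have hτ0 : 0 < τ := hι.trans_le hιτ
  obtain ⟨am, ap, hA, hxm, hxp⟩ := H.exists_coarseAxis hτ ha x
  have e : ∀ i : ℕ, (x * a * x⁻¹) ^ i * x = x * a ^ i := fun i => by
    rw [conj_pow]; simp
  have hxx := hA.nonneg x
  have hAe : ∀ i : ℕ, am (x * a ^ i) + ap (x * a ^ i) ≤ 0 := fun i => by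
    have h1 := hA.shift_left_zpow i x
    have h2 := hA.shift_right_zpow i x
    rw [zpow_natCast, e] at h1 h2
    linarith
  have hdist : ∀ i j : ℕ, i ≤ j → (j - i : ℝ) * τ ≤ d (x * a ^ i) (x * a ^ j) ∧
      d (x * a ^ i) (x * a ^ j) ≤ (j - i : ℝ) * τ + c := by
    intro i j hij
    rw [H.mul_left, H.dist_pow a (j - i) (by omega), ← Nat.cast_sub hij]
    exact ⟨H.mul_translationLength_le hτ _, ha _⟩
  set f := (r : ℝ) / ι + κ / η with hf
  have hf0 : 0 ≤ f := by positivity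
  -- `i₀` periods are discarded at each end. They are longer than `r + κ`, the distance required by
  -- `add_le_of_near` with error `2c`.
  set i₀ := ⌊f⌋₊ + 1 with hi₀
  have hi₀lo : f < i₀ := by rw [hi₀]; push_cast; exact Nat.lt_floor_add_one f
  have hi₀hi : (i₀ : ℝ) ≤ f + 1 := by
    rw [hi₀]; push_cast; linarith [Nat.floor_le hf0]
  have hi₀τ : r + κ < i₀ * τ := by
    have h1 : (r : ℝ) ≤ r / ι * τ := by
      rw [div_mul_eq_mul_div, le_div_iff₀ hι]; gcongr
    have h2 : κ ≤ κ / η * τ := by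
      rw [div_mul_eq_mul_div, le_div_iff₀ hη]; gcongr; linarith
    have h3 : f * τ < i₀ * τ := by gcongr
    rw [hf, add_mul] at h3
    linarith
  have hkC : 2 * i₀ + C ≤ k := by
    have : (2 * i₀ + C : ℝ) ≤ k := by
      refine le_trans ?_ hk
      rw [mul_div_assoc]
      linarith
    exact_mod_cast this
  have mid : ∀ i, i₀ ≤ i → i + i₀ ≤ k → bm (x * a ^ i) + bp (x * a ^ i) ≤ c₂ := by
    intro i h1 h2
    have h1' : (i₀ : ℝ) ≤ i := by exact_mod_cast h1
    have h2' : (i + i₀ : ℝ) ≤ k := by exact_mod_cast h2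
    have d1 := hdist 0 i (by omega)
    have d2 := hdist i k (by omega)
    have d3 := hdist 0 k (by omega)
    have g1 : (i₀ : ℝ) * τ ≤ (i - (0 : ℕ) : ℝ) * τ := by gcongr; simpa using h1'
    have g2 : (i₀ : ℝ) * τ ≤ (k - i : ℝ) * τ := by gcongr; linarith
    have hx0 : x * a ^ 0 = x := by simp
    rw [hx0] at d1 d3
    have h := hB.add_le_of_near H (p := x) (q := x * a ^ k) (w := x * a ^ i) (ρ := r) (E := 2 * c)
      (by linarith) (by linarith) hxr hkr (by linarith) (by linarith)
      (by linarith [H.symm (x * a ^ k) (x * a ^ i)])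
    linarith
  -- Here `|b| ≤ |a|` enters: `τ' ≤ |b| ≤ |a| ≤ τ + c`.
  have hb1 := H.mul_translationLength_le hτ' 1
  have ha1 := ha 1
  rw [pow_one] at hb1 ha1
  push_cast at hb1 ha1
  have hn : (x * a * x⁻¹) ^ (k - 2 * i₀) * (x * a ^ i₀) = x * a ^ (k - i₀) := by
    rw [← e i₀, ← mul_assoc, ← pow_add, ← e (k - i₀)]
    congr 2
    omega
  obtain ⟨m, hm, hcomm⟩ := hC (x * a * x⁻¹) (y * b * y⁻¹) τ τ' am ap bm bp (hA.mono (by linarith))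
    (hB.mono (by linarith)) (by linarith) (H.translationLength_nonneg hτ') (by linarith)
    (x * a ^ i₀) (k - 2 * i₀) (by omega) ((hAe _).trans hc₂0) (mid _ le_rfl (by omega))
    (by rw [hn]; exact mid _ (by omega) (by omega))
  refine H.exists_zpow_eq_of_commute hac hA hτ0 (by positivity) (x := x) ?_ hm hcomm ?_
  · have h1 : 0 ≤ 2 * c + δ + 2 := by positivity
    linarith
  · intro h
    obtain ⟨n, hn, hbn⟩ := isOfFinOrder_iff_pow_eq_one.1 h
    refine hb (isOfFinOrder_iff_pow_eq_one.2 ⟨n, hn, ?_⟩)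
    rwa [conj_pow, conj_eq_one_iff] at hbn

end GroupGeometry

/-! ### The periodicity theorem -/

theorem theorem1p3 {G : Type*} [Group G] (X : Set G)
    (hsymm : ∀ s ∈ X, s⁻¹ ∈ X) (hgen : Subgroup.closure X = ⊤)
    (hhyp : (SimpleGraph.mulCayley X).IsGromovHyperbolic)
    (hacyl : GroupGeometry.IsAcylindrical X) :
    ∃ C : ℝ, 0 < C ∧
      ∀ a b : G, GroupGeometry.IsLoxodromic X a → GroupGeometry.IsLoxodromic X b →
        GroupGeometry.IsShortestInConjClass X a → GroupGeometry.IsShortestInConjClass X b →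
        GroupGeometry.wordLength X b ≤ GroupGeometry.wordLength X a →
        -- `u` and `v` label the geodesic segments of which `L(x, a)` and `L(y, b)` are made
        ∀ u v : List G, GroupGeometry.IsShortestWordFor X u a →
          GroupGeometry.IsShortestWordFor X v b →
        ∀ (x y : G) (r : ℕ) (I : Set ℤ), I.OrdConnected →
          (∃ k : ℕ, 2 * (r : ℝ) / GroupGeometry.injRadius X + C ≤ k ∧
            GroupGeometry.ContainsPeriods u.length I k) →
          (∀ i ∈ I, ∃ j : ℤ, GroupGeometry.wordDist X (GroupGeometry.periodicPath x u i)
            (GroupGeometry.periodicPath y v j) ≤ r) →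
          (∃ s t : ℤ, s ≠ 0 ∧ t ≠ 0 ∧ (x⁻¹ * y) * b ^ s * (y⁻¹ * x) = a ^ t) ∧
            GroupGeometry.IsCommensurable a b := by
  open GroupGeometry in
  obtain ⟨δ, H⟩ := isHyperbolicMetric_wordDist hsymm hgen hhyp
  have hac := hacyl.isAcylindricalMetric
  obtain ⟨η, hη, hηle⟩ := H.exists_le_translationLength hac
  obtain ⟨c, hc, hpow⟩ := H.exists_dist_pow_le hη
  obtain ⟨C, hC0, hC⟩ := H.exists_zpow_eq_of_near hac hη hc
  have hTL := hasTranslationLength_stableNorm hsymm hgen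
  have hηlox : ∀ g, IsLoxodromic X g → η ≤ stableNorm X g := fun g hg =>
    hηle g _ (hTL g) (hg.translationLength_pos H (hTL g))
  have short : ∀ g, IsShortestInConjClass X g →
      ∀ h, (wordDist X 1 g : ℝ) ≤ wordDist X 1 (h⁻¹ * g * h) := fun g hg h => by
    simpa [wordDist] using hg h
  refine ⟨C, hC0, ?_⟩
  rintro a b ha hb has hbs hba u v hu hv x y r I - ⟨k, hk, n, hn⟩ hI
  have hinfa := H.not_isOfFinOrder (hTL a) (hη.trans_le (hηlox a ha))
  have hinfb := H.not_isOfFinOrder (hTL b) (hη.trans_le (hηlox b hb))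
  have hιa : injRadius X ≤ stableNorm X a := by
    refine csInf_le ⟨η, ?_⟩ ⟨a, ha, rfl⟩
    rintro _ ⟨g, hg, rfl⟩
    exact hηlox g hg
  have hηι : η ≤ injRadius X := by
    refine le_csInf ⟨_, a, ha, rfl⟩ ?_
    rintro _ ⟨g, hg, rfl⟩
    exact hηlox g hg
  have hul : u.length ≠ 0 := by
    intro h0
    rw [List.length_eq_zero_iff] at h0
    apply hinfa
    rw [← hu.1.2, h0]
    simp
  have hpa := hpow a _ (hTL a) (hηlox a ha) (short a has)
  have hpb := hpow b _ (hTL b) (hηlox b hb) (short b hbs)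
  obtain ⟨bm, bp, hB, hym, hyp⟩ := H.exists_coarseAxis (hTL b) hpb y
  -- Since `|b| ≤ ‖b‖ + c`, all vertices of `L(y, b)` are uniformly near the axis, however long `b`
  -- is.
  have hz : ∀ j, bm (periodicPath y v j) + bp (periodicPath y v j) ≤ c := fun j => by
    have h1 := hB.add_periodicPath_le H hv hym hyp j
    have h2 := hpb 1
    simp [wordDist] at h2
    linarith
  have hnk : (n : ℤ) * u.length ≤ (n + k) * u.length := by gcongr; omega
  -- Only the two extreme vertices of the `k` periods are needed.
  obtain ⟨j₀, hj₀⟩ := hI _ (hn ⟨le_rfl, hnk⟩)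
  obtain ⟨j₁, hj₁⟩ := hI _ (hn ⟨hnk, le_rfl⟩)
  rw [periodicPath_mul_length hul, hu.1.2] at hj₀ hj₁
  rw [zpow_add, zpow_natCast, ← mul_assoc] at hj₁
  -- Moving the base point from `x` to `x aⁿ` does not change the isometry `x a x⁻¹`.
  obtain ⟨s, t, hs, ht, hst⟩ := hC a b (x * a ^ n) y (periodicPath y v j₀) (periodicPath y v j₁)
    (stableNorm X a) (stableNorm X b) (injRadius X) bm bp (hTL a) hpa (hTL b) hinfb hB (hz _)
    (hz _) hηι hιa (by simpa [wordDist] using hba) r k hk (by exact_mod_cast hj₀)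
    (by exact_mod_cast hj₁)
  have key : (x⁻¹ * y) * b ^ s * (y⁻¹ * x) = a ^ t := by
    have e : x * a ^ n * a * (x * a ^ n)⁻¹ = x * a * x⁻¹ := by
      rw [mul_assoc x, ← zpow_add_one, add_comm, zpow_add, zpow_one]; group
    rw [e, conj_zpow, conj_zpow] at hst
    have := congrArg (fun g => x⁻¹ * g * x) hst
    simpa [mul_assoc] using this
  refine ⟨⟨s, t, hs, ht, key⟩, hinfa, hinfb, y⁻¹ * x, t, s, ht, hs, ?_⟩
  rw [← key]
  simp [mul_assoc]
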